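/- Let $m\ge 1$ and let $T_m$ be the rooted infinite $m$-ary tree, whose level-$n$ vertices are the words of length $n$ over $\{0,\dots,m-1\}$ and whose ends (rays) are the infinite words. For a root-preserving automorphism $g\in\operatorname{Aut}(T_m)$ and a vertex $v$, the section $g_v\in\operatorname{Aut}(T_m)$ is defined by $g(vx)=g(v)\,g_v(x)$ for all rays $x$; the activity $a_n(g)$ is the number of vertices $v$ of level $n$ with $g_v\neq 1$. An automaton group is a subgroup $G\le\operatorname{Aut}(T_m)$ generated by a finite set that contains all sections of its elements. It has degree $2$ if $a_n(g)=O(n^2)$ as $n\to\infty$ for every $g\in G$ (so groups of degree $0$ and $1$ are included). **Theorem.** Let $G\le\operatorname{Aut}(T_m)$ be an automaton group of degree $2$, and let $S$ be any finite generating set of $G$. Then the Schreier graph of the action of $G$ on the orbit of the zero ray $000\dots$, that is, the undirected multigraph with vertex set $G\cdot 000\dots$ and an edge joining $x$ and $s\cdot x$ for each vertex $x$ and each $s\in S$, is recurrent: the simple random walk started at any vertex returns to that vertex almost surely. (If $S=\emptyset$, the graph is a single vertex without edges, which counts as recurrent.) -/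

import Mathlib

open scoped ENNReal

/-- The ends of the rooted `m`-ary tree `T_m`: infinite words `x₀ x₁ x₂ …` over the alphabet
`{0, …, m - 1}`, the digit `x₀` being the one nearest to the root. Vertices of level `n` are
the finite words (lists) of length `n`; `v ++ₛ x` is the ray that passes through the vertex `v`
and then continues as `x`. -/
abbrev Ray (m : ℕ) : Type := Stream' (Fin m)

/-- The ray `000…`. -/
def zeroRay (m : ℕ) [NeZero m] : Ray m := Stream'.const 0

/-- The group `Aut(T_m)` of root-preserving automorphisms of the `m`-ary tree, through its
(faithful) action on the ends: the bijections `f` of the set of ends such that two ends agree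
up to level `n` if and only if their images do. -/
def TreeAut (m : ℕ) : Subgroup (Equiv.Perm (Ray m)) where
  carrier := {f | ∀ (n : ℕ) (x y : Ray m),
    (f x).take n = (f y).take n ↔ x.take n = y.take n}
  one_mem' := fun _ _ _ => Iff.rfl
  mul_mem' := fun {f g} hf hg n x y => (hf n (g x) (g y)).trans (hg n x y)
  inv_mem' := fun {f} hf n x y => by
    have h := hf n (f⁻¹ x) (f⁻¹ y)
    simpa using h.symm

theorem TreeAut.take_eq_iff {m : ℕ} (g : TreeAut m) (n : ℕ) (x y : Ray m) :
    (g.1 x).take n = (g.1 y).take n ↔ x.take n = y.take n :=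
  g.2 n x y

theorem Ray.take_length_append {m : ℕ} (v : List (Fin m)) (x : Ray m) :
    Stream'.take v.length (v ++ₛ x) = v := by
  rw [Stream'.take_append_of_le_length (h := le_rfl), List.take_length]

theorem Ray.take_add_eq_iff {m : ℕ} (k n : ℕ) (s t : Ray m) (h : s.take k = t.take k) :
    s.take (k + n) = t.take (k + n) ↔ (s.drop k).take n = (t.drop k).take n := by
  induction k generalizing s t with
  | zero => simp
  | succ k ih =>
    rw [Stream'.take_succ, Stream'.take_succ, List.cons.injEq] at h
    have e : k + 1 + n = (k + n) + 1 := by omega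
    rw [e, Stream'.take_succ, Stream'.take_succ, List.cons.injEq, Stream'.drop_succ,
      Stream'.drop_succ, ← ih _ _ h.2]
    exact ⟨fun H => H.2, fun H => ⟨h.1, H⟩⟩

/-- The section `g_v` of the tree automorphism `g` at the vertex `v`: the automorphism with
`g (v x) = g(v) g_v(x)` for every ray `x`. -/
def sectionAt {m : ℕ} (g : TreeAut m) (v : List (Fin m)) : TreeAut m :=
  ⟨{ toFun := fun x => (g.1 (v ++ₛ x)).drop v.length
     invFun := fun y =>
      (g.1.symm ((g.1 (v ++ₛ y)).take v.length ++ₛ y)).drop v.length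
     left_inv := fun x => by
      have h : (g.1 (v ++ₛ (g.1 (v ++ₛ x)).drop v.length)).take v.length
          = (g.1 (v ++ₛ x)).take v.length := by
        rw [TreeAut.take_eq_iff, Ray.take_length_append, Ray.take_length_append]
      simp only [h, Stream'.append_take_drop, Equiv.symm_apply_apply,
        Stream'.drop_append_stream]
     right_inv := fun y => by
      set w := (g.1 (v ++ₛ y)).take v.length with hw
      set z := g.1.symm (w ++ₛ y) with hz
      have hwl : w.length = v.length := by rw [hw, Stream'.length_take]
      have hgz : g.1 z = w ++ₛ y := by rw [hz, Equiv.apply_symm_apply]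
      have hzt : z.take v.length = v := by
        have h := (TreeAut.take_eq_iff g v.length z (v ++ₛ y)).1 (by
          rw [hgz, ← hw, ← hwl, Ray.take_length_append])
        rw [h, Ray.take_length_append]
      have hzv : v ++ₛ z.drop v.length = z := by
        have h := Stream'.append_take_drop v.length z
        rwa [hzt] at h
      show (g.1 (v ++ₛ z.drop v.length)).drop v.length = y
      rw [hzv, hgz, ← hwl, Stream'.drop_append_stream] },
   fun n x y => by
    have h1 : (g.1 (v ++ₛ x)).take v.length = (g.1 (v ++ₛ y)).take v.length := by
      rw [TreeAut.take_eq_iff, Ray.take_length_append, Ray.take_length_append]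
    have h2 : Stream'.take v.length (v ++ₛ x) = Stream'.take v.length (v ++ₛ y) := by
      rw [Ray.take_length_append, Ray.take_length_append]
    have h3 := Ray.take_add_eq_iff v.length n _ _ h1
    have h4 := Ray.take_add_eq_iff v.length n _ _ h2
    rw [Stream'.drop_append_stream, Stream'.drop_append_stream] at h4
    exact h3.symm.trans ((TreeAut.take_eq_iff g _ _ _).trans h4)⟩

/-- The activity `a_n(g)`: the number of vertices `v` of level `n` with `g_v ≠ 1`. -/
noncomputable def activity {m : ℕ} (g : TreeAut m) (n : ℕ) : ℕ :=
  Set.ncard {v : List (Fin m) | v.length = n ∧ sectionAt g v ≠ 1}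

/-- An automaton group: a subgroup of `Aut(T_m)` generated by a finite set that contains all
sections of its elements. -/
def IsAutomatonGroup {m : ℕ} (G : Subgroup (TreeAut m)) : Prop :=
  ∃ A : Set (TreeAut m), A.Finite ∧ (∀ g ∈ A, ∀ v : List (Fin m), sectionAt g v ∈ A) ∧
    Subgroup.closure A = G

/-- `G` has degree `d`: every `g ∈ G` has activity `a_n(g) = O(n ^ d)` as `n → ∞`. (As usual,
a group of degree `d` is also of degree `d'` for each `d' ≥ d`.) -/
def HasDegree {m : ℕ} (G : Subgroup (TreeAut m)) (d : ℕ) : Prop :=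
  ∀ g ∈ G, (fun n : ℕ => (activity g n : ℝ)) =O[Filter.atTop] fun n : ℕ => (n : ℝ) ^ d

open Classical in
/-- `avoidProb o n x` is the probability that the simple random walk on the quiver `V`, started
at `x`, is not at `o` at any of the times `1, …, n`. In each step the walk chooses one of the
arrows out of its current position uniformly at random and moves to the end of that arrow; the
recursion conditions on the first step. -/
noncomputable def avoidProb {V : Type*} [Quiver V] (o : V) : ℕ → V → ℝ≥0∞
  | 0, _ => 1
  | n + 1, x => ∑' e : Quiver.Star x,
      if e.1 = o then 0 else ((ENat.card (Quiver.Star x) : ℕ∞) : ℝ≥0∞)⁻¹ * avoidProb o n e.1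

/-- A locally finite quiver is recurrent if the simple random walk from any vertex returns to
that vertex almost surely, that is, if the probability of no return up to time `n` tends to `0`.
An undirected multigraph is treated as a quiver in which each edge (loops included) gives
one arrow in each direction; for a connected multigraph it does not matter which vertex is
used. A vertex without any edge counts as recurrent. -/
structure IsRecurrent (V : Type*) [Quiver V] : Prop where
  locallyFinite : ∀ x : V, Finite (Quiver.Star x)
  returns : ∀ o : V, Filter.Tendsto (fun n => avoidProb o n o) Filter.atTop (nhds 0)

/-- The Schreier graph of the action of `G`, with generating set `S`, on the orbit of the ray
`x`, as an undirected multigraph: the vertices are the points of the orbit, and for each vertex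
`y` and each `s ∈ S` there is an edge joining `y` and `s • y`. It is given as a quiver with each
edge present in both directions. -/
abbrev OrbitSchreierGraph {m : ℕ} (G : Subgroup (TreeAut m)) (S : Set G) (x : Ray m) : Type :=
  Quiver.Symmetrify
    (Quiver.SchreierGraph (MulAction.orbit G x) (fun s : S => (s : G)))

/-! Recurrence follows once there are finitely supported functions on the orbit whose values at a
given vertex tend to 1 and whose Dirichlet energies tend to 0, because the energy bounds the escape
probability (`exists_tendsto_le_energy`). Energies along products and inverses are controlled by
those of the factors (`tendsto_rayEnergy_of_closure`), so it suffices to treat the finite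
section-closed generating set `A`, with functions on all rays.

Rays are read in blocks of length `q * P`. During a block a state of positive growth exponent either
settles on a cycle of the automaton and becomes aligned, or drops to a smaller exponent
(`IsConfig.next_succ`); an aligned state that leaves its cycle also drops (`IsAligned.next_of_ne`).
The level-`n` function is 1 on rays that are `P`-periodic after `n` blocks, 0 on rays that are not
so after `n + 1` blocks, and takes a value `t` in the transition layer. Along a periodic run `t`
shrinks by the factor ρ = M / (M + 1), where M is the number of blocks, and it becomes 1 - t / (M +
1) when the run breaks. Aligned states of exponent at most 1 cost little when `t` is near 0,
finitary ones when `t` is near 1, and together this makes the energy of states of exponent 0 and 1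
decay like ρ ^ n.

Each further exponent essentially sums the energies of the preceding one over the levels: exponent 2
gives bounded energy, and exponent 3, which is quadratic activity, gives O(n)
(`exists_energy_le_of_three`). An edge is seen by at most five levels (`levelFun_lacunary`), so the
average of the level functions with weights proportional to 1 / (n + 1) has energy O(1 / H_N), where
H_N is the harmonic sum. This tends to 0 (`exists_almost_invariant`). -/

/-! ### Words, rays and periodic rays. -/

namespace Ray

variable {m : ℕ}

theorem take_append {v : List (Fin m)} {n : ℕ} (h : v.length = n) (y : Ray m) :
    Stream'.take n (v ++ₛ y) = v := by
  subst h; exact take_length_append v y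

theorem drop_append {v : List (Fin m)} {n : ℕ} (h : v.length = n) (y : Ray m) :
    Stream'.drop n (v ++ₛ y) = y := by
  subst h; exact Stream'.drop_append_stream v y

theorem take_append_add {v : List (Fin m)} (n : ℕ) (y : Ray m) :
    Stream'.take (v.length + n) (v ++ₛ y) = v ++ y.take n :=
  (Stream'.append_take ..).symm

theorem take_take_of_le {k n : ℕ} (h : k ≤ n) (y : Ray m) : (y.take n).take k = y.take k := by
  rw [Stream'.take_take, min_eq_right h]

theorem append_inj {v w : List (Fin m)} {x y : Ray m} (h : v ++ₛ x = w ++ₛ y)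
    (hl : v.length = w.length) : v = w ∧ x = y := by
  have hv := Stream'.append_left_injective _ _ _ _ h hl
  subst hv
  exact ⟨rfl, Stream'.append_right_injective _ _ _ h⟩

/-- The `k`-fold repetition of a word. -/
def rep (k : ℕ) (u : List (Fin m)) : List (Fin m) := (List.replicate k u).flatten

theorem rep_zero (u : List (Fin m)) : rep 0 u = [] := rfl

theorem rep_succ (k : ℕ) (u : List (Fin m)) : rep (k + 1) u = u ++ rep k u := by
  simp [rep, List.replicate_succ]

theorem rep_succ' (k : ℕ) (u : List (Fin m)) : rep (k + 1) u = rep k u ++ u := by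
  simp [rep, List.replicate_succ']

@[simp]
theorem length_rep (k : ℕ) (u : List (Fin m)) : (rep k u).length = k * u.length := by
  simp [rep]

theorem rep_append_eq {u : List (Fin m)} {y : Ray m} (h : u ++ₛ y = y) (k : ℕ) :
    rep k u ++ₛ y = y := by
  induction k with
  | zero => rfl
  | succ k ih => rw [rep_succ, Stream'.append_append_stream, ih, h]

theorem periodic_unique {u : List (Fin m)} (hu : u ≠ []) {y z : Ray m} (hy : u ++ₛ y = y)
    (hz : u ++ₛ z = z) : y = z := by
  refine Stream'.take_theorem _ _ fun n => ?_
  have hn : n ≤ n * u.length :=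
    Nat.le_mul_of_pos_right n (List.length_pos_iff.2 hu)
  have key : ∀ x : Ray m, u ++ₛ x = x → x.take n = (rep n u).take n := fun x hx => by
    rw [← Ray.take_take_of_le hn x, ← rep_append_eq hx n, Ray.take_append (length_rep n u)]
  rw [key y hy, key z hz]

end Ray

/-! ### Images of words and the calculus of sections. -/

namespace TreeAut

open Ray

variable {m : ℕ}

theorem ext_apply {g h : TreeAut m} (H : ∀ y, g.1 y = h.1 y) : g = h :=
  Subtype.ext (Equiv.ext H)

variable [NeZero m]

/-- The image `g(v)` of the vertex `v`. -/
def onWord (g : TreeAut m) (v : List (Fin m)) : List (Fin m) :=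
  (g.1 (v ++ₛ zeroRay m)).take v.length

@[simp]
theorem length_onWord (g : TreeAut m) (v : List (Fin m)) : (onWord g v).length = v.length :=
  Stream'.length_take ..

theorem apply_append (g : TreeAut m) (v : List (Fin m)) (y : Ray m) :
    g.1 (v ++ₛ y) = onWord g v ++ₛ (sectionAt g v).1 y := by
  have h : (g.1 (v ++ₛ y)).take v.length = onWord g v := by
    rw [onWord, take_eq_iff, Ray.take_length_append, Ray.take_length_append]
  rw [← h]
  exact (Stream'.append_take_drop v.length _).symm

/-- Uniqueness of the decomposition g(vy) = g(v) g_v(y); it lets identities for images and sections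
be read off from the action on rays. -/
theorem eq_of_apply_append {g h : TreeAut m} {v w : List (Fin m)} (hl : w.length = v.length)
    (H : ∀ y, g.1 (v ++ₛ y) = w ++ₛ h.1 y) : onWord g v = w ∧ sectionAt g v = h := by
  have key : ∀ y, onWord g v = w ∧ (sectionAt g v).1 y = h.1 y := fun y =>
    Ray.append_inj ((apply_append g v y).symm.trans (H y)) (by simp [hl])
  exact ⟨(key (zeroRay m)).1, ext_apply fun y => (key y).2⟩

theorem append_section (g : TreeAut m) (v w : List (Fin m)) :
    onWord g (v ++ w) = onWord g v ++ onWord (sectionAt g v) w ∧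
      sectionAt g (v ++ w) = sectionAt (sectionAt g v) w :=
  eq_of_apply_append (by simp) fun y => by
    rw [Stream'.append_append_stream, apply_append, apply_append, Stream'.append_append_stream]

theorem onWord_append (g : TreeAut m) (v w : List (Fin m)) :
    onWord g (v ++ w) = onWord g v ++ onWord (sectionAt g v) w :=
  (append_section g v w).1

theorem sectionAt_append (g : TreeAut m) (v w : List (Fin m)) :
    sectionAt g (v ++ w) = sectionAt (sectionAt g v) w :=
  (append_section g v w).2

theorem one_section (v : List (Fin m)) : onWord (1 : TreeAut m) v = v ∧ sectionAt 1 v = 1 :=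
  eq_of_apply_append rfl fun _ => rfl

@[simp]
theorem onWord_one (v : List (Fin m)) : onWord (1 : TreeAut m) v = v := (one_section v).1

@[simp]
theorem sectionAt_one (v : List (Fin m)) : sectionAt (1 : TreeAut m) v = 1 := (one_section v).2

@[simp]
theorem sectionAt_nil (g : TreeAut m) : sectionAt g [] = g :=
  (eq_of_apply_append (w := []) rfl fun _ => rfl).2

theorem onWord_injective (g : TreeAut m) {v w : List (Fin m)} (h : onWord g v = onWord g w) :
    v = w := by
  have hl : v.length = w.length := by rw [← length_onWord g v, h, length_onWord]
  have := (take_eq_iff g v.length (v ++ₛ zeroRay m) (w ++ₛ zeroRay m)).1 (by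
    rw [← onWord, h, onWord, hl])
  rwa [Ray.take_length_append, hl, Ray.take_length_append] at this

theorem sectionAt_rep {g : TreeAut m} {u : List (Fin m)} (h : sectionAt g u = g) (k : ℕ) :
    sectionAt g (rep k u) = g := by
  induction k with
  | zero => simp [rep_zero]
  | succ k ih => rw [rep_succ, sectionAt_append, h, ih]

theorem onWord_rep {g : TreeAut m} {u : List (Fin m)} (h : sectionAt g u = g) (k : ℕ) :
    onWord g (rep k u) = rep k (onWord g u) := by
  induction k with
  | zero => rfl
  | succ k ih => rw [rep_succ, onWord_append, h, ih, rep_succ]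

end TreeAut

/-! ### Core activity and growth exponents. -/

namespace TreeAut

open Ray

variable {m : ℕ}

/-- A tree automorphism is finitary if its sections at some level are all trivial. -/
def Finitary (s : TreeAut m) : Prop :=
  ∃ n, ∀ v : List (Fin m), v.length = n → sectionAt s v = 1

/-- The number of vertices of level `n` at which the section is not finitary. -/
noncomputable def coreActivity (s : TreeAut m) (n : ℕ) : ℕ :=
  Set.ncard {v : List (Fin m) | v.length = n ∧ ¬ Finitary (sectionAt s v)}

/-- The core activity is `O(n ^ (e - 1))`; for `e = 0` it vanishes. -/
def CoreGrowth (e : ℕ) (s : TreeAut m) : Prop :=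
  ∃ C : ℕ, ∀ n, (n + 1) * coreActivity s n ≤ C * (n + 1) ^ e

theorem finite_level (p : List (Fin m) → Prop) (n : ℕ) :
    {v : List (Fin m) | v.length = n ∧ p v}.Finite :=
  (List.finite_length_eq (Fin m) n).subset fun _ h => h.1

variable [NeZero m]

theorem Finitary.of_le {s : TreeAut m} {n : ℕ} (h : ∀ v : List (Fin m), v.length = n →
    sectionAt s v = 1) (v : List (Fin m)) (hv : n ≤ v.length) : sectionAt s v = 1 := by
  rw [← List.take_append_drop n v, sectionAt_append, h _ (by simp [hv]), sectionAt_one]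

theorem finitary_one : Finitary (1 : TreeAut m) := ⟨0, fun v _ => sectionAt_one v⟩

theorem finitary_of_children {s : TreeAut m} (h : ∀ c : Fin m, Finitary (sectionAt s [c])) :
    Finitary s := by
  choose n hn using h
  refine ⟨Finset.univ.sup n + 1, fun v hv => ?_⟩
  obtain - | ⟨c, v⟩ := v
  · simp at hv
  · have hc : n c ≤ v.length := by
      have : n c ≤ Finset.univ.sup n := Finset.le_sup (Finset.mem_univ c)
      simp at hv; omega
    have := sectionAt_append s [c] v
    rw [List.singleton_append] at this
    rw [this]
    exact Finitary.of_le (hn c) v hc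

/-- Repeating `u` reaches the depth where all sections are trivial, while the section is still `s`.
-/
theorem Finitary.eq_one {s : TreeAut m} (h : Finitary s) {u : List (Fin m)} (hu : u ≠ [])
    (hs : _root_.sectionAt s u = s) : s = 1 := by
  obtain ⟨n, hn⟩ := h
  rw [← sectionAt_rep hs n]
  refine Finitary.of_le hn _ ?_
  rw [length_rep]
  exact Nat.le_mul_of_pos_right n (List.length_pos_iff.2 hu)

theorem coreActivity_section_le (s : TreeAut m) (v : List (Fin m)) (n : ℕ) :
    coreActivity (sectionAt s v) n ≤ coreActivity s (v.length + n) := by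
  refine Set.ncard_le_ncard_of_injOn (v ++ ·) ?_ (fun _ _ _ _ h => List.append_cancel_left h)
    (finite_level _ _)
  rintro w ⟨hw, hf⟩
  exact ⟨by simp [hw], by rwa [sectionAt_append]⟩

/-- A non-finitary section has a non-finitary child. The plain activity need not be monotone, which
is the reason for counting non-finitary sections. -/
theorem coreActivity_mono (s : TreeAut m) : Monotone (coreActivity s) := by
  refine monotone_nat_of_le_succ fun n => ?_
  have key : ∀ v : List (Fin m), ∃ c : Fin m, ¬ Finitary (sectionAt s v) →
      ¬ Finitary (sectionAt s (v ++ [c])) := fun v => by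
    by_contra! H
    refine (H 0).1 (finitary_of_children fun c => ?_)
    rw [← sectionAt_append]
    exact (H c).2
  choose c hc using key
  refine Set.ncard_le_ncard_of_injOn (fun v => v ++ [c v]) ?_ ?_ (finite_level _ _)
  · rintro w ⟨hw, hf⟩
    exact ⟨by simp [hw], hc w hf⟩
  · intro v hv w hw h
    exact (List.append_inj h (hv.1.trans hw.1.symm)).1

/-- Since `v` is not a prefix of `u`, the subtrees below `u` and `v` are disjoint; monotonicity
makes up for the difference of their depths. -/
theorem coreActivity_add_le (s : TreeAut m) {u v : List (Fin m)} (hvu : v.length ≤ u.length)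
    (hne : v ≠ u.take v.length) (n : ℕ) :
    coreActivity (sectionAt s u) n + coreActivity (sectionAt s v) n
      ≤ coreActivity s (u.length + n) := by
  calc _ ≤ coreActivity (sectionAt s u) n
        + coreActivity (sectionAt s v) (u.length - v.length + n) :=
        Nat.add_le_add_left (coreActivity_mono _ (by omega)) _
    _ = Set.ncard ((u ++ ·) '' {w : List (Fin m) | w.length = n ∧
          ¬ Finitary (sectionAt (sectionAt s u) w)}) +
        Set.ncard ((v ++ ·) '' {w : List (Fin m) | w.length = u.length - v.length + n ∧
          ¬ Finitary (sectionAt (sectionAt s v) w)}) := by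
        rw [Set.ncard_image_of_injective _ (fun _ _ h => List.append_cancel_left h),
          Set.ncard_image_of_injective _ (fun _ _ h => List.append_cancel_left h)]
        rfl
    _ = Set.ncard (_ ∪ _) := (Set.ncard_union_eq (by
          rw [Set.disjoint_left]
          rintro _ ⟨w, -, rfl⟩ ⟨w', -, h⟩
          apply hne
          have := congrArg (List.take v.length) h
          simpa [List.take_append_of_le_length hvu] using this)
          ((finite_level _ _).image _) ((finite_level _ _).image _)).symm
    _ ≤ _ := by
        refine Set.ncard_le_ncard ?_ (finite_level _ _)
        rintro _ (⟨w, ⟨hw, hf⟩, rfl⟩ | ⟨w, ⟨hw, hf⟩, rfl⟩)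
        · exact ⟨by simp [hw], by rwa [sectionAt_append]⟩
        · exact ⟨by simp [hw]; omega, by rwa [sectionAt_append]⟩

/-- Each of the first `j` turns around the loop `u` offers an exit through `v`, and the exits lead
to disjoint subtrees. -/
theorem mul_coreActivity_le {s : TreeAut m} {u v : List (Fin m)} (hs : sectionAt s u = s)
    (hvu : v.length ≤ u.length) (hne : v ≠ u.take v.length) (n j : ℕ) :
    j * coreActivity (sectionAt s v) n ≤ coreActivity s (j * u.length + n) := by
  induction j with
  | zero => simp
  | succ j ih =>
    have h := coreActivity_add_le s hvu hne (j * u.length + n)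
    rw [hs] at h
    have h' := coreActivity_mono (sectionAt s v) (show n ≤ j * u.length + n by omega)
    have e : (j + 1) * u.length + n = u.length + (j * u.length + n) := by ring
    rw [e, add_mul, one_mul]
    omega

/-- Leaving a cycle of the automaton lowers the growth exponent. -/
theorem CoreGrowth.section_of_cycle {e : ℕ} {s : TreeAut m} (h : CoreGrowth (e + 1) s)
    {u v : List (Fin m)} (hs : sectionAt s u = s) (hvu : v.length ≤ u.length)
    (hne : v ≠ u.take v.length) : CoreGrowth e (sectionAt s v) := by
  obtain ⟨C, hC⟩ := h
  -- With `n + 1` turns, the exits at depth `n` multiply the activity by `n + 1`, while the level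
  -- reached is still linear in `n`.
  refine ⟨C * (u.length + 1) ^ e, fun n => (mul_coreActivity_le hs hvu hne n (n + 1)).trans ?_⟩
  set N := (n + 1) * u.length + n
  have h1 := hC N
  rw [pow_succ, ← mul_assoc, mul_comm (N + 1)] at h1
  have h2 : coreActivity s N ≤ C * (N + 1) ^ e := Nat.le_of_mul_le_mul_right h1 (by omega)
  have h3 : N + 1 = (u.length + 1) * (n + 1) := by simp only [N]; ring
  rwa [h3, mul_pow, ← mul_assoc] at h2

theorem CoreGrowth.sectionAt {e : ℕ} {s : TreeAut m} (h : CoreGrowth e s) (v : List (Fin m)) :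
    CoreGrowth e (sectionAt s v) := by
  obtain ⟨C, hC⟩ := h
  refine ⟨C * (v.length + 1) ^ e, fun n => ?_⟩
  calc (n + 1) * coreActivity (_root_.sectionAt s v) n
      ≤ (v.length + n + 1) * coreActivity s (v.length + n) :=
        Nat.mul_le_mul (by omega) (coreActivity_section_le s v n)
    _ ≤ C * (v.length + n + 1) ^ e := hC _
    _ ≤ C * ((v.length + 1) * (n + 1)) ^ e :=
        Nat.mul_le_mul_left _ (Nat.pow_le_pow_left (by nlinarith [Nat.zero_le (v.length * n)]) _)
    _ = _ := by rw [mul_pow, mul_assoc]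

/-- At `n = C` the bound forces a vanishing count; monotonicity carries this back to the root. -/
theorem CoreGrowth.finitary {s : TreeAut m} (h : CoreGrowth 0 s) : Finitary s := by
  obtain ⟨C, hC⟩ := h
  have h0 : coreActivity s 0 = 0 := by
    by_contra hne
    have h1 := hC C
    have h2 := coreActivity_mono s (Nat.zero_le C)
    have : (C + 1) * 1 ≤ (C + 1) * coreActivity s C := Nat.mul_le_mul_left _ (by omega)
    simp at h1
    omega
  by_contra hs
  have : ([] : List (Fin m)) ∈ ({v : List (Fin m) | v.length = 0 ∧
      ¬ Finitary (_root_.sectionAt s v)}) := ⟨rfl, by rwa [sectionAt_nil]⟩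
  rw [coreActivity, Set.ncard_eq_zero (finite_level _ _)] at h0
  rw [h0] at this
  exact this

theorem coreActivity_le_activity (s : TreeAut m) (n : ℕ) : coreActivity s n ≤ activity s n :=
  Set.ncard_le_ncard (fun _ hv => ⟨hv.1, fun h => hv.2 (h ▸ finitary_one)⟩) (finite_level _ _)

theorem coreGrowth_of_isBigO {s : TreeAut m} {d : ℕ} (h : (fun n : ℕ => (activity s n : ℝ))
    =O[Filter.atTop] fun n : ℕ => (n : ℝ) ^ d) : CoreGrowth (d + 1) s := by
  obtain ⟨c, hc⟩ := h.bound
  obtain ⟨N, hN⟩ := Filter.eventually_atTop.1 hc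
  obtain ⟨C, hC⟩ := exists_nat_ge c
  -- The second summand covers the levels below `N`, by monotonicity.
  refine ⟨C + coreActivity s N, fun n => ?_⟩
  rw [pow_succ', mul_left_comm]
  refine Nat.mul_le_mul_left _ ?_
  have hp : 1 ≤ (n + 1) ^ d := Nat.one_le_pow _ _ (by omega)
  obtain hn | hn := le_total n N
  · calc coreActivity s n ≤ coreActivity s N := coreActivity_mono s hn
      _ ≤ (C + coreActivity s N) * 1 := by omega
      _ ≤ _ := Nat.mul_le_mul_left _ hp
  · have h1 := hN n hn
    rw [Real.norm_natCast, norm_pow, Real.norm_natCast] at h1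
    have h2 : (activity s n : ℝ) ≤ ((C * n ^ d : ℕ) : ℝ) := by
      push_cast
      exact h1.trans (by gcongr)
    calc coreActivity s n ≤ activity s n := coreActivity_le_activity s n
      _ ≤ C * n ^ d := by exact_mod_cast h2
      _ ≤ _ := Nat.mul_le_mul (by omega) (Nat.pow_le_pow_left (by omega) _)

end TreeAut

/-! ### Reading a ray in blocks: aligned states and loss of growth. -/

namespace TreeAut

open Ray

variable {m : ℕ}

/-- The last `P` letters of a word. -/
def lastLetters (P : ℕ) (c : List (Fin m)) : List (Fin m) := c.drop (c.length - P)

theorem length_lastLetters {P : ℕ} {c : List (Fin m)} (h : P ≤ c.length) :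
    (lastLetters P c).length = P := by
  simp [lastLetters]; omega

theorem lastLetters_append {P : ℕ} (v : List (Fin m)) {u : List (Fin m)} (h : u.length = P) :
    lastLetters P (v ++ u) = u := by
  simp [lastLetters, h]

theorem lastLetters_rep {P q : ℕ} (hq : 0 < q) {u : List (Fin m)} (h : u.length = P) :
    lastLetters P (rep q u) = u := by
  obtain ⟨k, rfl⟩ : ∃ k, q = k + 1 := ⟨q - 1, by omega⟩
  rw [rep_succ', lastLetters_append _ h]

/-- A finite set of tree automorphisms closed under sections, with a period `P` and a block
length `q * P`: along each block, every state runs into a cycle whose length divides `P`, and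
finitary states die out, with at least `P` letters to spare. -/
structure IsBlocked (A : Set (TreeAut m)) (P q : ℕ) : Prop where
  section_mem : ∀ s ∈ A, ∀ v : List (Fin m), sectionAt s v ∈ A
  period_pos : 0 < P
  le_block : P ≤ q * P
  exists_cycle : ∀ s ∈ A, ∀ c : List (Fin m), c.length = q * P → ∃ i j, i < j ∧ j + P ≤ q * P ∧
    j - i ∣ P ∧ sectionAt s (c.take i) = sectionAt s (c.take j)
  finitary : ∀ s ∈ A, Finitary s → ∀ c : List (Fin m), c.length + P = q * P → sectionAt s c = 1

/-- A state of growth exponent `e`, together with the last `P` letters `u` of the input and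
`u'` of the output read so far. -/
structure IsConfig (A : Set (TreeAut m)) (P e : ℕ) (s : TreeAut m) (u u' : List (Fin m)) :
    Prop where
  mem : s ∈ A
  growth : CoreGrowth e s
  length_in : u.length = P
  length_out : u'.length = P

/-- A configuration is aligned if the state is fixed by repeating the last `P` letters. -/
structure IsAligned (A : Set (TreeAut m)) (P e : ℕ) (s : TreeAut m) (u u' : List (Fin m)) : Prop
    extends IsConfig A P e s u u' where
  apply_append : ∀ y, s.1 (u ++ₛ y) = u' ++ₛ s.1 y

variable {A : Set (TreeAut m)} {P q e : ℕ} {s : TreeAut m} {u u' c : List (Fin m)}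

theorem IsBlocked.block_pos (hB : IsBlocked A P q) : 0 < q := by
  have h1 := hB.le_block
  have h2 := hB.period_pos
  by_contra h
  obtain rfl : q = 0 := by omega
  omega

theorem IsAligned.periodic_iff (h : IsAligned A P e s u u') (y : Ray m) :
    u' ++ₛ s.1 y = s.1 y ↔ u ++ₛ y = y := by
  rw [← h.apply_append, s.1.injective.eq_iff]

variable [NeZero m]

theorem exists_isBlocked (hA : A.Finite)
    (hs : ∀ s ∈ A, ∀ v : List (Fin m), sectionAt s v ∈ A) : ∃ P q, IsBlocked A P q := by
  have hdepth : ∀ s ∈ A, ∃ n, Finitary s → ∀ v : List (Fin m), n ≤ v.length →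
      sectionAt s v = 1 := fun s _ => by
    by_cases h : Finitary s
    · obtain ⟨n, hn⟩ := h
      exact ⟨n, fun _ => Finitary.of_le hn⟩
    · exact ⟨0, fun h' => absurd h' h⟩
  choose! D hD using hdepth
  set N := A.ncard with hN
  set d := hA.toFinset.sup D
  -- Among `N + 1` prefixes two have the same section, so a cycle of length at most `N`, hence
  -- dividing `N!`, appears; the summand `d` exceeds the depth of every finitary state.
  refine ⟨N.factorial, N + d + 1, hs, Nat.factorial_pos N,
    Nat.le_mul_of_pos_left _ (by omega), fun s h c hc => ?_, fun s h hf c hc => ?_⟩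
  · have hmaps : Set.MapsTo (fun i => sectionAt s (c.take i)) (Finset.range (N + 1))
        hA.toFinset := fun i _ => by simpa using hs s h _
    obtain ⟨i, hi, j, hj, hij, he⟩ := Finset.exists_ne_map_eq_of_card_lt_of_maps_to
      (by rw [← Set.ncard_eq_toFinset_card _ hA, ← hN, Finset.card_range]; omega) hmaps
    rw [Finset.mem_range] at hi hj
    wlog hlt : i < j generalizing i j
    · exact this j hj i hi hij.symm he.symm (by omega)
    have hp := Nat.factorial_pos N
    refine ⟨i, j, hlt, ?_, Nat.dvd_factorial (by omega) (by omega), he⟩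
    nlinarith
  · refine hD s h hf c ?_
    have hd : D s ≤ d := Finset.le_sup (hA.mem_toFinset.2 h)
    have hp := Nat.factorial_pos N
    nlinarith

theorem IsAligned.onWord_section (h : IsAligned A P e s u u') :
    onWord s u = u' ∧ sectionAt s u = s :=
  eq_of_apply_append (by rw [h.length_in, h.length_out]) h.apply_append

theorem IsAligned.eq_one (hB : IsBlocked A P q) (h : IsAligned A P 0 s u u') :
    s = 1 ∧ u' = u := by
  have hu : u ≠ [] := by
    rintro rfl
    have := hB.period_pos
    have := h.length_in
    simp at this; omega
  obtain rfl : s = 1 := h.growth.finitary.eq_one hu h.onWord_section.2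
  exact ⟨rfl, by rw [← h.onWord_section.1, onWord_one]⟩

theorem IsAligned.section_rep (h : IsAligned A P e s u u') (q : ℕ) :
    sectionAt s (rep q u) = s ∧ onWord s (rep q u) = rep q u' := by
  rw [onWord_rep h.onWord_section.2, h.onWord_section.1]
  exact ⟨sectionAt_rep h.onWord_section.2 q, rfl⟩

theorem IsConfig.next (hB : IsBlocked A P q) (h : IsConfig A P e s u u')
    (hc : c.length = q * P) :
    IsConfig A P e (sectionAt s c) (lastLetters P c) (lastLetters P (onWord s c)) :=
  ⟨hB.section_mem s h.mem c, h.growth.sectionAt c,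
    length_lastLetters (hc ▸ hB.le_block),
    length_lastLetters (by rw [length_onWord]; exact hc ▸ hB.le_block)⟩

/-- Injectivity on words makes input and output break their periods in the same block, and the state
leaves the loop `u ^ q`, which lowers the exponent. -/
theorem IsAligned.next_of_ne (hB : IsBlocked A P q) (h : IsAligned A P (e + 1) s u u')
    (hc : c.length = q * P) (hne : c ≠ Ray.rep q u) : onWord s c ≠ Ray.rep q u' ∧
      IsConfig A P e (sectionAt s c) (lastLetters P c) (lastLetters P (onWord s c)) := by
  refine ⟨fun he => hne (onWord_injective s (he.trans (h.section_rep q).2.symm)), ?_⟩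
  have hl : (Ray.rep q u).length = c.length := by rw [length_rep, h.length_in, hc]
  exact { h.toIsConfig.next hB hc with
    growth := h.growth.section_of_cycle (h.section_rep q).1 hl.ge (by rwa [← hl, List.take_length]) }

/-- A finitary state dies before the last `P` letters of the block, so these are copied unchanged.
-/
theorem IsConfig.next_zero (hB : IsBlocked A P q) (h : IsConfig A P 0 s u u')
    (hc : c.length = q * P) :
    IsAligned A P 0 (sectionAt s c) (lastLetters P c) (lastLetters P (onWord s c)) := by
  have hle := hB.le_block
  have hd : c = c.take (c.length - P) ++ lastLetters P c := (List.take_append_drop _ _).symm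
  have h1 : sectionAt s (c.take (c.length - P)) = 1 :=
    hB.finitary s h.mem h.growth.finitary _ (by simp; omega)
  have hl : (lastLetters P c).length = P := length_lastLetters (by omega)
  have hs : sectionAt s c = 1 := by rw [hd, sectionAt_append, h1, sectionAt_one]
  have ho : lastLetters P (onWord s c) = lastLetters P c := by
    conv_lhs => rw [hd]
    rw [onWord_append, h1, onWord_one, lastLetters_append _ hl]
  refine { h.next hB hc with apply_append := fun y => ?_ }
  rw [hs, ho]
  rfl

/-- Within the block the state reaches some `r` on a cycle labelled `v`. If the rest of the block
follows `v v v …`, its last `P` letters go around the cycle a whole number of times and form a loop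
at the final state. Otherwise the path leaves a cycle. -/
theorem IsConfig.next_succ (hB : IsBlocked A P q) (h : IsConfig A P (e + 1) s u u')
    (hc : c.length = q * P) :
    IsAligned A P (e + 1) (sectionAt s c) (lastLetters P c) (lastLetters P (onWord s c)) ∨
      IsConfig A P e (sectionAt s c) (lastLetters P c) (lastLetters P (onWord s c)) := by
  obtain ⟨i, j, hij, hj, ⟨k, hk⟩, he⟩ := hB.exists_cycle s h.mem c hc
  set r := sectionAt s (c.take i) with hr
  set v := (c.drop i).take (j - i) with hv
  set d := c.drop i with hd
  have hcd : c = c.take i ++ d := (List.take_append_drop _ _).symm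
  have hvl : v.length = j - i := by simp [hv, hd]; omega
  have hdl : d.length = q * P - i := by simp [hd, hc]
  have hrv : sectionAt r v = r := by
    rw [hr, ← sectionAt_append, hv, hd, ← List.take_add, Nat.add_sub_cancel' hij.le, ← he]
  have hrd : sectionAt s c = sectionAt r d := by rw [hcd, sectionAt_append]
  have hvne : v ≠ [] := by rintro hv0; rw [hv0] at hvl; simp at hvl; omega
  set z : Ray m := Stream'.cycle v hvne
  have hz : v ++ₛ z = z := (Stream'.cycle_eq v hvne).symm
  have hzrep : ∀ l, rep l v ++ₛ z = z := rep_append_eq hz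
  by_cases hdz : d = z.take d.length
  · left
    have hPl : (rep k v).length = P := by rw [length_rep, hvl, hk]; ring
    set d1 := d.take (d.length - P) with hd1
    have hdd : d = d1 ++ lastLetters P d := (List.take_append_drop _ _).symm
    have hl : (lastLetters P d).length = P := length_lastLetters (by omega)
    have hd1z : d1 = z.take (d.length - P) := by
      rw [hd1, hdz, take_take_of_le (by simp)]
    -- Because `d` is a prefix of a periodic ray, its last `P` letters may be traded for `k` initial
    -- turns; hence `d` and `d1` lead to the same state.
    have hdrep : d = rep k v ++ d1 := by
      conv_lhs => rw [hdz, ← hzrep k, show d.length = (rep k v).length + (d.length - P) by omega]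
      rw [take_append_add, ← hd1z]
    have hr1 : sectionAt r d = sectionAt r d1 := by
      conv_lhs => rw [hdrep]
      rw [sectionAt_append, sectionAt_rep hrv]
    have hcl : c = (c.take i ++ d1) ++ lastLetters P d := by
      rw [List.append_assoc, ← hdd, ← hcd]
    have hlast : lastLetters P c = lastLetters P d := by
      conv_lhs => rw [hcl]
      rw [lastLetters_append _ hl]
    have hout : lastLetters P (onWord s c) = onWord (sectionAt r d1) (lastLetters P d) := by
      conv_lhs => rw [hcl]
      rw [onWord_append, lastLetters_append _ (by rw [length_onWord, hl]), sectionAt_append]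
    refine { h.next hB hc with apply_append := fun y => ?_ }
    rw [hlast, hout, hrd]
    conv_lhs => rw [hr1]
    rw [TreeAut.apply_append, ← sectionAt_append r d1, ← hdd]
  · right
    refine { h.next hB hc with growth := ?_ }
    rw [hrd]
    have hg : CoreGrowth (e + 1) r := h.growth.sectionAt _
    have hle : d.length ≤ (rep d.length v).length := by
      rw [length_rep]
      exact Nat.le_mul_of_pos_right _ (by omega)
    refine hg.section_of_cycle (sectionAt_rep hrv d.length) hle ?_
    intro h'
    apply hdz
    rw [← hzrep d.length, Stream'.take_append_of_le_length (h := hle)]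
    exact h'

end TreeAut

/-! ### Potentials and their energy. -/

namespace TreeAut

open Ray

variable {m : ℕ}

/-- The number of words of length `q * P`. -/
noncomputable def blockCount (m P q : ℕ) : ℝ := (m : ℝ) ^ (q * P)

/-- The contraction ratio of the potential along a periodic block. -/
noncomputable def ratio (m P q : ℕ) : ℝ := blockCount m P q / (blockCount m P q + 1)

/-- Update of the value `t` of the potential when the block `c` is read after the `P` letters
`u`. -/
noncomputable def update (P q : ℕ) (t : ℝ) (u c : List (Fin m)) : ℝ :=
  if c = rep q u then ratio m P q * t else 1 - t / (blockCount m P q + 1)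

/-- After `n` blocks, the ray `y` (preceded by the `P` letters `u`) is periodic. -/
def PeriodicAfter (P q : ℕ) : ℕ → List (Fin m) → Ray m → Prop
  | 0, u, y => u ++ₛ y = y
  | n + 1, _, y => PeriodicAfter P q n (lastLetters P (y.take (q * P))) (y.drop (q * P))

open Classical in
/-- The potential with a transition at block `k`: it is `1` on rays that are periodic after `k`
blocks, `0` on rays that are not periodic after `k + 1` blocks, and in between on the rest. -/
noncomputable def potential (P q : ℕ) : ℕ → ℝ → List (Fin m) → Ray m → ℝ
  | 0, t, u, y => if PeriodicAfter P q 0 u y then 1 else if PeriodicAfter P q 1 u y then t else 0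
  | k + 1, t, u, y => potential P q k (update P q t u (y.take (q * P)))
      (lastLetters P (y.take (q * P))) (y.drop (q * P))

/-- The energy of the potential along the edges from `u y` to `u' s(y)`. -/
noncomputable def energy (P q : ℕ) (s : TreeAut m) (k : ℕ) (t t' : ℝ) (u u' : List (Fin m)) :
    ℝ≥0∞ :=
  ∑' y, ENNReal.ofReal ((potential P q k t' u' (s.1 y) - potential P q k t u y) ^ 2)

section Basic

variable {P q : ℕ} {u c : List (Fin m)} {t : ℝ} {y : Ray m}

theorem blockCount_nonneg : 0 ≤ blockCount m P q := by unfold blockCount; positivity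

theorem ratio_nonneg : 0 ≤ ratio m P q := by
  have := blockCount_nonneg (m := m) (P := P) (q := q)
  unfold ratio; positivity

theorem ratio_eq : ratio m P q = 1 - 1 / (blockCount m P q + 1) := by
  have := blockCount_nonneg (m := m) (P := P) (q := q)
  unfold ratio; field_simp; ring

theorem ratio_lt_one : ratio m P q < 1 := by
  have := blockCount_nonneg (m := m) (P := P) (q := q)
  rw [ratio_eq]
  have : 0 < 1 / (blockCount m P q + 1) := by positivity
  linarith

theorem update_mem (ht : t ∈ Set.Icc (0 : ℝ) 1) : update P q t u c ∈ Set.Icc (0 : ℝ) 1 := by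
  have h0 := blockCount_nonneg (m := m) (P := P) (q := q)
  have h1 := ratio_nonneg (m := m) (P := P) (q := q)
  have h2 := ratio_lt_one (m := m) (P := P) (q := q)
  unfold update
  split_ifs
  · exact ⟨mul_nonneg h1 ht.1, mul_le_one₀ h2.le ht.1 ht.2⟩
  · have h3 : t / (blockCount m P q + 1) ≤ 1 := div_le_one_of_le₀ (by linarith [ht.2]) (by linarith)
    have h4 : 0 ≤ t / (blockCount m P q + 1) := div_nonneg ht.1 (by linarith)
    exact ⟨by linarith, by linarith⟩

theorem periodicAfter_append (hc : c.length = q * P) (n : ℕ) :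
    PeriodicAfter P q (n + 1) u (c ++ₛ y) ↔ PeriodicAfter P q n (lastLetters P c) y := by
  rw [PeriodicAfter, take_append hc, drop_append hc]

theorem potential_append (hc : c.length = q * P) (k : ℕ) : potential P q (k + 1) t u (c ++ₛ y) =
    potential P q k (update P q t u c) (lastLetters P c) y := by
  rw [potential, take_append hc, drop_append hc]

theorem potential_mem (ht : t ∈ Set.Icc (0 : ℝ) 1) (k : ℕ) :
    potential P q k t u y ∈ Set.Icc (0 : ℝ) 1 := by
  induction k generalizing t u y with
  | zero =>
    unfold potential
    split_ifs
    · simp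
    · exact ht
    · simp
  | succ k ih => exact ih (update_mem ht)

theorem PeriodicAfter.succ (hq : 0 < q) (hP : P ≤ q * P) (hu : u.length = P) {n : ℕ}
    (h : PeriodicAfter P q n u y) : PeriodicAfter P q (n + 1) u y := by
  induction n generalizing u y with
  | zero =>
    have h' : rep q u ++ₛ y = y := rep_append_eq h q
    have hl : (rep q u).length = q * P := by rw [length_rep, hu]
    rw [← h', periodicAfter_append hl, lastLetters_rep hq hu]
    exact h
  | succ n ih => exact ih (length_lastLetters (by simpa using hP)) h

theorem PeriodicAfter.mono (hq : 0 < q) (hP : P ≤ q * P) (hu : u.length = P) {n k : ℕ}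
    (hnk : n ≤ k) (h : PeriodicAfter P q n u y) : PeriodicAfter P q k u y := by
  induction hnk with
  | refl => exact h
  | step _ ih => exact ih.succ hq hP hu

theorem potential_eq_one {k : ℕ} (h : PeriodicAfter P q k u y) : potential P q k t u y = 1 := by
  induction k generalizing t u y with
  | zero => exact if_pos h
  | succ k ih => exact ih h

theorem potential_eq_zero (hq : 0 < q) (hP : P ≤ q * P) (hu : u.length = P) {k : ℕ}
    (h : ¬ PeriodicAfter P q (k + 1) u y) : potential P q k t u y = 0 := by
  induction k generalizing t u y with
  | zero =>
    have h0 : ¬ PeriodicAfter P q 0 u y := fun h' => h (h'.succ hq hP hu)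
    rw [potential, if_neg h0, if_neg h]
  | succ k ih => exact ih (length_lastLetters (by simpa using hP)) h

theorem finite_periodicAfter (hP0 : 0 < P) (hP : P ≤ q * P) (hu : u.length = P) (n : ℕ) :
    {y : Ray m | PeriodicAfter P q n u y}.Finite := by
  induction n generalizing u with
  | zero =>
    refine Set.Subsingleton.finite fun y hy z hz => ?_
    refine periodic_unique ?_ hy hz
    rintro rfl
    simp at hu; omega
  | succ n ih =>
    refine ((List.finite_length_eq (Fin m) (q * P)).biUnion fun c hc =>
      (ih (u := lastLetters P c) (length_lastLetters (hP.trans hc.ge))).image (c ++ₛ ·)).subset ?_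
    intro y hy
    simp only [Set.mem_iUnion]
    exact ⟨y.take (q * P), by simp, _, hy, Stream'.append_take_drop _ y⟩

end Basic

/-- Rays split into their first `n` letters and the remaining ray. -/
def splitEquiv (m n : ℕ) : Ray m ≃ List.Vector (Fin m) n × Ray m where
  toFun y := (⟨y.take n, Stream'.length_take n y⟩, y.drop n)
  invFun p := p.1.toList ++ₛ p.2
  left_inv y := Stream'.append_take_drop n y
  right_inv := fun ⟨⟨_, hv⟩, y⟩ =>
    Prod.ext (List.Vector.eq _ _ (take_append hv y)) (drop_append hv y)

theorem tsum_split (F : Ray m → ℝ≥0∞) (n : ℕ) :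
    ∑' y, F y = ∑ c : List.Vector (Fin m) n, ∑' y, F (c.toList ++ₛ y) := by
  rw [← (splitEquiv m n).symm.tsum_eq F, ENNReal.tsum_prod', tsum_fintype]
  rfl

theorem sum_block_le {P q : ℕ} {F : List.Vector (Fin m) (q * P) → ℝ≥0∞} {B : ℝ}
    (h : ∀ c, F c ≤ ENNReal.ofReal B) : ∑ c, F c ≤ ENNReal.ofReal (blockCount m P q * B) := by
  refine (Finset.sum_le_card_nsmul _ _ _ fun c _ => h c).trans ?_
  rw [Finset.card_univ, card_vector, Fintype.card_fin, nsmul_eq_mul,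
    ENNReal.ofReal_mul blockCount_nonneg, blockCount, ← Nat.cast_pow, ENNReal.ofReal_natCast]

-- After each first block at most one tail is periodic with the prescribed period, so the support
-- has at most one ray per block.
open Classical in
theorem tsum_periodicAfter_le {P q : ℕ} (hP0 : 0 < P) (hP : P ≤ q * P) (u : List (Fin m)) (B : ℝ) :
    ∑' y, (if PeriodicAfter P q 1 u y then ENNReal.ofReal B else 0) ≤
      ENNReal.ofReal (blockCount m P q * B) := by
  rw [tsum_split _ (q * P)]
  refine sum_block_le fun c => ?_
  simp only [periodicAfter_append c.toList_length]
  by_cases h : ∃ z, PeriodicAfter P q 0 (lastLetters P c.toList) z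
  · obtain ⟨z, hz⟩ := h
    rw [tsum_eq_single z, if_pos hz]
    intro y hy
    refine if_neg fun hy' => hy (periodic_unique ?_ hy' hz)
    intro h0
    have := length_lastLetters (hP.trans c.toList_length.ge)
    rw [h0] at this
    simp at this; omega
  · push Not at h
    simp [h]

variable {A : Set (TreeAut m)} {P q e k : ℕ} {s : TreeAut m} {u u' c : List (Fin m)} {t t' B : ℝ}

open Classical in
theorem energy_zero_le (hA : IsBlocked A P q) (hc : IsConfig A P e s u u')
    (ht : t ∈ Set.Icc (0 : ℝ) 1) (ht' : t' ∈ Set.Icc (0 : ℝ) 1) :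
    energy P q s 0 t t' u u' ≤ ENNReal.ofReal (2 * blockCount m P q) := by
  have h1 := tsum_periodicAfter_le hA.period_pos hA.le_block u 1
  have h2 := tsum_periodicAfter_le hA.period_pos hA.le_block u' 1
  rw [← s.1.tsum_eq] at h2
  have h0 := blockCount_nonneg (m := m) (P := P) (q := q)
  calc _ ≤ _ := ENNReal.tsum_le_tsum fun y => ?_
    _ ≤ _ := (ENNReal.tsum_add).trans_le (add_le_add h1 h2)
    _ = _ := by rw [← ENNReal.ofReal_add (by linarith) (by linarith)]; ring_nf
  have hp := potential_mem (P := P) (q := q) (u := u) (y := y) ht 0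
  have hp' := potential_mem (P := P) (q := q) (u := u') (y := s.1 y) ht' 0
  have hle : ENNReal.ofReal ((potential P q 0 t' u' (s.1 y) - potential P q 0 t u y) ^ 2) ≤
      ENNReal.ofReal 1 := by
    apply ENNReal.ofReal_le_ofReal
    rw [sq_le_one_iff_abs_le_one, abs_le]
    exact ⟨by linarith [hp.2, hp'.1], by linarith [hp.1, hp'.2]⟩
  by_cases hy : PeriodicAfter P q 1 u y
  · rw [if_pos hy]
    exact hle.trans le_self_add
  by_cases hy' : PeriodicAfter P q 1 u' (s.1 y)
  · rw [if_pos hy']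
    exact hle.trans le_add_self
  rw [potential_eq_zero hA.block_pos hA.le_block hc.length_in hy,
    potential_eq_zero hA.block_pos hA.le_block hc.length_out hy']
  simp

variable [NeZero m]

theorem one_le_blockCount {P q : ℕ} : 1 ≤ blockCount m P q :=
  one_le_pow₀ (by exact_mod_cast NeZero.one_le)

theorem energy_succ (s : TreeAut m) (k : ℕ) (t t' : ℝ) (u u' : List (Fin m)) :
    energy P q s (k + 1) t t' u u' = ∑ c : List.Vector (Fin m) (q * P),
      energy P q (sectionAt s c.toList) k (update P q t u c.toList) (update P q t' u' (onWord s c.toList))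
        (lastLetters P c.toList) (lastLetters P (onWord s c.toList)) := by
  rw [energy, tsum_split _ (q * P)]
  refine Finset.sum_congr rfl fun c _ => tsum_congr fun y => ?_
  rw [apply_append, potential_append c.toList_length, potential_append ((length_onWord s c.toList).trans c.toList_length)]

theorem energy_succ_le (h : ∀ c : List (Fin m), c.length = q * P →
    energy P q (sectionAt s c) k (update P q t u c) (update P q t' u' (onWord s c))
      (lastLetters P c) (lastLetters P (onWord s c)) ≤ ENNReal.ofReal B) :
    energy P q s (k + 1) t t' u u' ≤ ENNReal.ofReal (blockCount m P q * B) := by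
  rw [energy_succ]
  exact sum_block_le fun c => h c.toList c.toList_length

/-- The block `u ^ q` returns to the same configuration with both values scaled by the ratio; it is
split off from the other blocks so that an induction on `k` can follow it. -/
theorem IsAligned.energy_succ_le (hA : IsBlocked A P q) (ha : IsAligned A P e s u u')
    (h : ∀ c : List (Fin m), c.length = q * P → c ≠ rep q u →
    energy P q (sectionAt s c) k (update P q t u c) (update P q t' u' (onWord s c))
      (lastLetters P c) (lastLetters P (onWord s c)) ≤ ENNReal.ofReal B) :
    energy P q s (k + 1) t t' u u' ≤
      energy P q s k (ratio m P q * t) (ratio m P q * t') u u' +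
      ENNReal.ofReal (blockCount m P q * B) := by
  rw [energy_succ]
  set T : List.Vector (Fin m) (q * P) → ℝ≥0∞ := fun c =>
    energy P q (sectionAt s c.toList) k (update P q t u c.toList)
      (update P q t' u' (onWord s c.toList)) (lastLetters P c.toList)
      (lastLetters P (onWord s c.toList)) with hT
  let c₀ : List.Vector (Fin m) (q * P) := ⟨rep q u, by rw [length_rep, ha.length_in]⟩
  have h₀ : T c₀ = energy P q s k (ratio m P q * t) (ratio m P q * t') u u' := by
    have hr := ha.section_rep q
    simp only [hT, c₀, List.Vector.toList_mk, hr.1, hr.2, update, if_true,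
      lastLetters_rep hA.block_pos ha.length_in, lastLetters_rep hA.block_pos ha.length_out]
  calc ∑ c, T c ≤ ∑ c, ((if c = c₀ then T c else 0) + if c = c₀ then 0 else T c) :=
        Finset.sum_le_sum fun c _ => by split_ifs <;> simp
    _ = T c₀ + ∑ c, if c = c₀ then 0 else T c := by
        rw [Finset.sum_add_distrib, Finset.sum_ite_eq' Finset.univ c₀ T,
          if_pos (Finset.mem_univ _)]
    _ ≤ _ := add_le_add h₀.le (sum_block_le fun c => ?_)
  split_ifs with hc
  · exact zero_le
  · exact h _ c.toList_length fun h' => hc (List.Vector.eq _ _ h')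

end TreeAut

/-! ### Energy estimates by growth exponent. -/

namespace TreeAut

open Ray

variable {m : ℕ} {A : Set (TreeAut m)} {P q e k : ℕ} {s : TreeAut m} {u u' c : List (Fin m)}
  {t t' B : ℝ}

theorem ratio_mul : ratio m P q * (blockCount m P q + 1) = blockCount m P q := by
  have := blockCount_nonneg (m := m) (P := P) (q := q)
  unfold ratio; field_simp

/-- Alignment makes the value 1 occur at both ends of an edge or at neither, so only the transition
values contribute. -/
theorem IsAligned.energy_zero_le [NeZero m] (hA : IsBlocked A P q) (ha : IsAligned A P e s u u')
    (ht : 0 ≤ t) (ht' : 0 ≤ t') :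
    energy P q s 0 t t' u u' ≤ ENNReal.ofReal (blockCount m P q * (t + t') ^ 2) := by
  classical
  have h1 := tsum_periodicAfter_le hA.period_pos hA.le_block u (t ^ 2)
  have h2 := tsum_periodicAfter_le hA.period_pos hA.le_block u' (t' ^ 2)
  rw [← s.1.tsum_eq] at h2
  have h0 := blockCount_nonneg (m := m) (P := P) (q := q)
  calc _ ≤ _ := ENNReal.tsum_le_tsum fun y => ?_
    _ ≤ _ := (ENNReal.tsum_add).trans_le (add_le_add h1 h2)
    _ = ENNReal.ofReal (blockCount m P q * (t ^ 2 + t' ^ 2)) := by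
        rw [← ENNReal.ofReal_add (by positivity) (by positivity)]; ring_nf
    _ ≤ _ := ENNReal.ofReal_le_ofReal
        (mul_le_mul_of_nonneg_left (by nlinarith [mul_nonneg ht ht']) h0)
  have hiff : PeriodicAfter P q 0 u' (s.1 y) ↔ PeriodicAfter P q 0 u y := ha.periodic_iff y
  by_cases h : PeriodicAfter P q 0 u y
  · rw [potential_eq_one h, potential_eq_one (hiff.2 h)]
    simp
  · simp only [potential, if_neg h, if_neg (hiff.not.2 h)]
    rw [← ENNReal.ofReal_zero, ← apply_ite ENNReal.ofReal, ← apply_ite ENNReal.ofReal,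
      ← ENNReal.ofReal_add (by split_ifs <;> positivity) (by split_ifs <;> positivity)]
    apply ENNReal.ofReal_le_ofReal
    split_ifs <;> nlinarith [mul_nonneg ht ht']

/-- On identical tails the potential contracts. -/
theorem IsAligned.energy_le_of_zero [NeZero m] (hA : IsBlocked A P q)
    (ha : IsAligned A P 0 s u u') :
    energy P q s k t t' u u' ≤
      ENNReal.ofReal (blockCount m P q * ratio m P q ^ k * (t - t') ^ 2) := by
  classical
  have h0 := blockCount_nonneg (m := m) (P := P) (q := q)
  have hr := ratio_nonneg (m := m) (P := P) (q := q)
  induction k generalizing s u u' t t' with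
  | zero =>
    obtain ⟨rfl, rfl⟩ := ha.eq_one hA
    rw [pow_zero, mul_one]
    refine le_trans (ENNReal.tsum_le_tsum fun y => ?_)
      (tsum_periodicAfter_le hA.period_pos hA.le_block u' ((t - t') ^ 2))
    change ENNReal.ofReal ((potential P q 0 t' u' y - potential P q 0 t u' y) ^ 2) ≤ _
    rw [← ENNReal.ofReal_zero, ← apply_ite ENNReal.ofReal]
    apply ENNReal.ofReal_le_ofReal
    unfold potential
    split_ifs <;> nlinarith [sq_nonneg (t - t')]
  | succ k ih =>
    set M := blockCount m P q with hM
    set ρ := ratio m P q with hρ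
    have hρ' : ρ = 1 - 1 / (M + 1) := ratio_eq
    refine (ha.energy_succ_le hA (B := M * ρ ^ k * ((t - t') / (M + 1)) ^ 2)
      fun c hc hne => (ih (ha.toIsConfig.next_zero hA hc)).trans_eq ?_).trans ?_
    · obtain ⟨rfl, rfl⟩ := ha.eq_one hA
      rw [onWord_one, update, update, if_neg hne, if_neg hne]
      congr 2
      ring
    · refine (add_le_add (ih ha) le_rfl).trans ?_
      rw [← ENNReal.ofReal_add (by positivity) (by positivity)]
      apply ENNReal.ofReal_le_ofReal
      -- The ratio is chosen for this identity: the periodic block contributes ρ ^ 2 and the others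
      -- at most M / (M + 1) ^ 2 = ρ (1 - ρ), in total ρ.
      have : M * ((t - t') / (M + 1)) ^ 2 = ρ * (1 - ρ) * (t - t') ^ 2 := by
        rw [hρ']; field_simp; ring
      calc _ = M * ρ ^ k * (ρ ^ 2 * (t - t') ^ 2 + M * ((t - t') / (M + 1)) ^ 2) := by ring
        _ ≤ _ := le_of_eq (by rw [this]; ring)

/-- Both branches of `update` take the value ρ at `t = 1`. So even if only one end of the edge
continues its period, the new values are close when `t` and `t'` are near 1. -/
theorem one_sub_update_le (ht : t ∈ Set.Icc (0 : ℝ) 1) (ht' : t' ∈ Set.Icc (0 : ℝ) 1)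
    (v c' : List (Fin m)) :
    (update P q t u c - update P q t' v c') ^ 2 ≤ ((1 - t) + (1 - t')) ^ 2 := by
  have h0 := blockCount_nonneg (m := m) (P := P) (q := q)
  have hr := ratio_nonneg (m := m) (P := P) (q := q)
  have hr1 := ratio_lt_one (m := m) (P := P) (q := q)
  have hρ : ratio m P q = 1 - 1 / (blockCount m P q + 1) := ratio_eq
  set ρ := ratio m P q
  have hdiv : ∀ x : ℝ, x / (blockCount m P q + 1) = x * (1 - ρ) := fun x => by rw [hρ]; ring
  rw [sq_le_sq, abs_of_nonneg (show 0 ≤ (1 - t) + (1 - t') by linarith [ht.2, ht'.2]), abs_le]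
  obtain ⟨a, b⟩ := ht
  obtain ⟨a', b'⟩ := ht'
  unfold update
  simp only [hdiv]
  split_ifs <;> constructor <;> nlinarith

/-- A finitary state costs little when the potential is close to `1`. -/
theorem IsConfig.energy_le_of_zero [NeZero m] (hA : IsBlocked A P q)
    (ha : IsConfig A P 0 s u u') (ht : t ∈ Set.Icc (0 : ℝ) 1) (ht' : t' ∈ Set.Icc (0 : ℝ) 1) :
    energy P q s k t t' u u' ≤ ENNReal.ofReal (blockCount m P q * (blockCount m P q + 1) *
      ratio m P q ^ k * ((1 - t) + (1 - t')) ^ 2) := by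
  classical
  have h0 := blockCount_nonneg (m := m) (P := P) (q := q)
  have hr := ratio_nonneg (m := m) (P := P) (q := q)
  have hrM := ratio_mul (m := m) (P := P) (q := q)
  cases k with
  | zero =>
    refine le_trans (ENNReal.tsum_le_tsum fun y => ?_)
      ((tsum_periodicAfter_le hA.period_pos hA.le_block u (((1 - t) + (1 - t')) ^ 2)).trans ?_)
    · have hiff : PeriodicAfter P q 1 u' (s.1 y) ↔ PeriodicAfter P q 1 u y := by
        rw [← Stream'.append_take_drop (q * P) y, TreeAut.apply_append,
          periodicAfter_append (by simp), periodicAfter_append (by simp)]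
        exact (ha.next_zero hA (by simp)).periodic_iff _
      by_cases h : PeriodicAfter P q 1 u y
      · rw [if_pos h]
        apply ENNReal.ofReal_le_ofReal
        obtain ⟨a, b⟩ := ht
        obtain ⟨a', b'⟩ := ht'
        simp only [potential, h, hiff.2 h, if_true]
        split_ifs <;> nlinarith
      · rw [potential_eq_zero hA.block_pos hA.le_block ha.length_in h,
          potential_eq_zero hA.block_pos hA.le_block ha.length_out (hiff.not.2 h)]
        simp
    · apply ENNReal.ofReal_le_ofReal
      rw [pow_zero, mul_one]
      have : 0 ≤ blockCount m P q * blockCount m P q * ((1 - t) + (1 - t')) ^ 2 := by positivity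
      linarith
  | succ k =>
    refine (energy_succ_le (B := blockCount m P q * ratio m P q ^ k * ((1 - t) + (1 - t')) ^ 2)
      fun c hc => ((ha.next_zero hA hc).energy_le_of_zero hA).trans ?_).trans_eq ?_
    · apply ENNReal.ofReal_le_ofReal
      exact mul_le_mul_of_nonneg_left (one_sub_update_le ht ht' _ _) (by positivity)
    · congr 1
      rw [pow_succ]
      linear_combination -(blockCount m P q * ratio m P q ^ k * ((1 - t) + (1 - t')) ^ 2) * hrM

/-- An aligned bounded state costs little when the potential is close to `0`. -/
theorem IsAligned.energy_le_of_one [NeZero m] (hA : IsBlocked A P q)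
    (ha : IsAligned A P 1 s u u') (ht : t ∈ Set.Icc (0 : ℝ) 1) (ht' : t' ∈ Set.Icc (0 : ℝ) 1) :
    energy P q s k t t' u u' ≤ ENNReal.ofReal (blockCount m P q * (blockCount m P q + 1) *
      ratio m P q ^ k * (t + t') ^ 2) := by
  have h0 := blockCount_nonneg (m := m) (P := P) (q := q)
  have hr := ratio_nonneg (m := m) (P := P) (q := q)
  have hr1 := ratio_lt_one (m := m) (P := P) (q := q)
  have hρ' : ratio m P q = 1 - 1 / (blockCount m P q + 1) := ratio_eq
  induction k generalizing t t' with
  | zero =>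
    refine (ha.energy_zero_le hA ht.1 ht'.1).trans (ENNReal.ofReal_le_ofReal ?_)
    rw [pow_zero, mul_one]
    have : 0 ≤ blockCount m P q * blockCount m P q * (t + t') ^ 2 := by positivity
    linarith
  | succ k ih =>
    set M := blockCount m P q with hM
    set ρ := ratio m P q with hρ
    have hs : ∀ x ∈ Set.Icc (0 : ℝ) 1, ρ * x ∈ Set.Icc (0 : ℝ) 1 := fun x hx =>
      ⟨mul_nonneg hr hx.1, mul_le_one₀ hr1.le hx.1 hx.2⟩
    refine (ha.energy_succ_le hA (B := M * (M + 1) * ρ ^ k * ((t + t') / (M + 1)) ^ 2)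
      fun c hc hne => ?_).trans ?_
    -- Both ends break their period, so the new distances from 1 are `t / (M + 1)` and `t' / (M +
    -- 1)`: the bound near 1 for finitary states turns into a bound near 0.
    · obtain ⟨hne', hnext⟩ := ha.next_of_ne hA hc hne
      refine (hnext.energy_le_of_zero hA (update_mem ht) (update_mem ht')).trans_eq ?_
      rw [update, update, if_neg hne, if_neg hne']
      congr 2
      ring
    · refine (add_le_add (ih (hs t ht) (hs t' ht')) le_rfl).trans ?_
      rw [← ENNReal.ofReal_add (by positivity) (by positivity)]
      apply ENNReal.ofReal_le_ofReal
      have : M * ((t + t') / (M + 1)) ^ 2 = ρ * (1 - ρ) * (t + t') ^ 2 := by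
        rw [hρ']; field_simp; ring
      calc _ = M * (M + 1) * ρ ^ k * (ρ ^ 2 * (t + t') ^ 2 + M * ((t + t') / (M + 1)) ^ 2) := by
            ring
        _ ≤ _ := le_of_eq (by rw [this]; ring)

theorem IsConfig.energy_le_of_next [NeZero m] (hA : IsBlocked A P q)
    (ha : IsConfig A P (e + 1) s u u') {B : ℕ → ℝ}
    (ht : t ∈ Set.Icc (0 : ℝ) 1) (ht' : t' ∈ Set.Icc (0 : ℝ) 1)
    (hal : ∀ {s u u' t t'}, IsAligned A P (e + 1) s u u' → t ∈ Set.Icc (0 : ℝ) 1 →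
      t' ∈ Set.Icc (0 : ℝ) 1 → energy P q s k t t' u u' ≤ ENNReal.ofReal (B k))
    (hna : ∀ {s u u' t t'}, IsConfig A P e s u u' → t ∈ Set.Icc (0 : ℝ) 1 →
      t' ∈ Set.Icc (0 : ℝ) 1 → energy P q s k t t' u u' ≤ ENNReal.ofReal (B k)) :
    energy P q s (k + 1) t t' u u' ≤ ENNReal.ofReal (blockCount m P q * B k) :=
  energy_succ_le fun _ hc => (ha.next_succ hA hc).elim
    (fun h => hal h (update_mem ht) (update_mem ht'))
    fun h => hna h (update_mem ht) (update_mem ht')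

/-- If lower states have summable energies, then aligned states have the sum as a bound. -/
theorem IsAligned.energy_le_of_next [NeZero m] (hA : IsBlocked A P q)
    (ha : IsAligned A P (e + 1) s u u') {B D : ℕ → ℝ} (hB : ∀ k, 0 ≤ B k)
    (hD0 : 2 * blockCount m P q ≤ D 0) (hD : ∀ k, D k + blockCount m P q * B k ≤ D (k + 1))
    (ht : t ∈ Set.Icc (0 : ℝ) 1) (ht' : t' ∈ Set.Icc (0 : ℝ) 1)
    (hna : ∀ {k s u u' t t'}, IsConfig A P e s u u' → t ∈ Set.Icc (0 : ℝ) 1 →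
      t' ∈ Set.Icc (0 : ℝ) 1 → energy P q s k t t' u u' ≤ ENNReal.ofReal (B k)) :
    energy P q s k t t' u u' ≤ ENNReal.ofReal (D k) := by
  have h0 := blockCount_nonneg (m := m) (P := P) (q := q)
  have hr := ratio_nonneg (m := m) (P := P) (q := q)
  have hr1 := ratio_lt_one (m := m) (P := P) (q := q)
  have hDn : ∀ k, 0 ≤ D k := fun k => by
    induction k with
    | zero => linarith
    | succ k ih => linarith [hD k, mul_nonneg h0 (hB k)]
  induction k generalizing t t' with
  | zero =>
    exact (TreeAut.energy_zero_le hA ha.toIsConfig ht ht').trans (ENNReal.ofReal_le_ofReal hD0)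
  | succ k ih =>
    have hs : ∀ x ∈ Set.Icc (0 : ℝ) 1, ratio m P q * x ∈ Set.Icc (0 : ℝ) 1 := fun x hx =>
      ⟨mul_nonneg hr hx.1, mul_le_one₀ hr1.le hx.1 hx.2⟩
    refine (ha.energy_succ_le hA (B := B k) fun c hc hne =>
      hna (ha.next_of_ne hA hc hne).2 (update_mem ht) (update_mem ht')).trans ?_
    refine (add_le_add (ih (hs t ht) (hs t' ht')) le_rfl).trans ?_
    rw [← ENNReal.ofReal_add (hDn k) (mul_nonneg h0 (hB k))]
    exact ENNReal.ofReal_le_ofReal (hD k)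

/-- States of bounded activity have exponentially small energy. -/
theorem IsConfig.energy_le_of_one [NeZero m] (hA : IsBlocked A P q)
    (ha : IsConfig A P 1 s u u') (ht : t ∈ Set.Icc (0 : ℝ) 1) (ht' : t' ∈ Set.Icc (0 : ℝ) 1) :
    energy P q s k t t' u u' ≤ ENNReal.ofReal
      (4 * blockCount m P q * (blockCount m P q + 1) ^ 2 * ratio m P q ^ k) := by
  have h0 := blockCount_nonneg (m := m) (P := P) (q := q)
  have hr := ratio_nonneg (m := m) (P := P) (q := q)
  have hrM := ratio_mul (m := m) (P := P) (q := q)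
  have hsq : ∀ a b : ℝ, a ∈ Set.Icc (0 : ℝ) 1 → b ∈ Set.Icc (0 : ℝ) 1 → (a + b) ^ 2 ≤ 4 :=
    fun a b ha hb => by nlinarith [ha.1, ha.2, hb.1, hb.2]
  cases k with
  | zero =>
    refine (energy_zero_le hA ha ht ht').trans (ENNReal.ofReal_le_ofReal ?_)
    rw [pow_zero, mul_one]
    nlinarith [mul_nonneg h0 h0, mul_nonneg h0 (mul_nonneg h0 h0)]
  | succ k =>
    have hB : 0 ≤ blockCount m P q * (blockCount m P q + 1) * ratio m P q ^ k := by positivity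
    refine (ha.energy_le_of_next hA (k := k)
      (B := fun k => blockCount m P q * (blockCount m P q + 1) * ratio m P q ^ k * 4) ht ht'
      (fun h h1 h2 => (h.energy_le_of_one hA h1 h2).trans (ENNReal.ofReal_le_ofReal
        (mul_le_mul_of_nonneg_left (hsq _ _ h1 h2) hB)))
      (fun h h1 h2 => (h.energy_le_of_zero hA h1 h2).trans (ENNReal.ofReal_le_ofReal
        (mul_le_mul_of_nonneg_left (hsq _ _ ⟨by linarith [h1.2], by linarith [h1.1]⟩
          ⟨by linarith [h2.2], by linarith [h2.1]⟩) hB)))).trans_eq ?_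
    congr 1
    rw [pow_succ]
    linear_combination (-4 * blockCount m P q * (blockCount m P q + 1) * ratio m P q ^ k) * hrM

/-- States of linear activity have bounded energy. -/
theorem IsBlocked.exists_energy_le_of_two [NeZero m] (hA : IsBlocked A P q) : ∃ C : ℝ, 0 ≤ C ∧
    ∀ {k s u u' t t'}, IsConfig A P 2 s u u' → t ∈ Set.Icc (0 : ℝ) 1 →
      t' ∈ Set.Icc (0 : ℝ) 1 → energy P q s k t t' u u' ≤ ENNReal.ofReal C := by
  have h1 := one_le_blockCount (m := m) (P := P) (q := q)
  have hr := ratio_nonneg (m := m) (P := P) (q := q)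
  have hr1 := ratio_lt_one (m := m) (P := P) (q := q)
  have hρ' : ratio m P q = 1 - 1 / (blockCount m P q + 1) := ratio_eq
  set M := blockCount m P q with hM
  set ρ := ratio m P q with hρ
  set c : ℝ := 4 * M * (M + 1) ^ 2 with hc
  have hc0 : 0 ≤ c := by positivity
  have hal : ∀ {k s u u' t t'}, IsAligned A P 2 s u u' → t ∈ Set.Icc (0 : ℝ) 1 →
      t' ∈ Set.Icc (0 : ℝ) 1 → energy P q s k t t' u u' ≤
        ENNReal.ofReal (2 * M + M * c * (M + 1)) := fun {k s u u' t t'} h ht ht' => by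
    -- Here `D` is the partial sum of a geometric series, with 1 / (1 - ρ) = M + 1.
    refine (h.energy_le_of_next (D := fun k => 2 * M + M * c * (M + 1) * (1 - ρ ^ k))
      hA (B := fun k => c * ρ ^ k) (fun k => by positivity) (by simp [hM]) (fun k => le_of_eq ?_)
      ht ht' (fun h h1 h2 => h.energy_le_of_one hA h1 h2)).trans (ENNReal.ofReal_le_ofReal ?_)
    · rw [pow_succ, ← hM]
      have : (M + 1) * (1 - ρ) = 1 := by rw [hρ']; field_simp; ring
      linear_combination (-(M * c * ρ ^ k)) * this
    · have : 0 ≤ M * c * (M + 1) * ρ ^ k := by positivity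
      nlinarith
  have hC : 0 ≤ 2 * M + M * c * (M + 1) + c := by positivity
  refine ⟨M * (2 * M + M * c * (M + 1) + c), by positivity, fun {k s u u' t t'} h ht ht' => ?_⟩
  cases k with
  | zero =>
    refine (energy_zero_le hA h ht ht').trans (ENNReal.ofReal_le_ofReal ?_)
    have : 0 ≤ M * c * (M + 1) + c := by positivity
    rw [← hM]
    nlinarith
  | succ k =>
    refine h.energy_le_of_next (k := k) hA (B := fun _ => 2 * M + M * c * (M + 1) + c) ht ht'
      (fun h h1 h2 => (hal h h1 h2).trans (ENNReal.ofReal_le_ofReal (by linarith)))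
      (fun h h1 h2 => (h.energy_le_of_one hA h1 h2).trans (ENNReal.ofReal_le_ofReal ?_))
    have h3 : c * ρ ^ k ≤ c * 1 := mul_le_mul_of_nonneg_left (pow_le_one₀ hr hr1.le) hc0
    have : 0 ≤ 2 * M + M * c * (M + 1) := by positivity
    linarith

/-- States of quadratic activity have at most linearly growing energy. -/
theorem IsBlocked.exists_energy_le_of_three [NeZero m] (hA : IsBlocked A P q) : ∃ C : ℝ, 0 ≤ C ∧
    ∀ {k s u u' t t'}, IsConfig A P 3 s u u' → t ∈ Set.Icc (0 : ℝ) 1 →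
      t' ∈ Set.Icc (0 : ℝ) 1 → energy P q s k t t' u u' ≤ ENNReal.ofReal (C * (k + 1)) := by
  obtain ⟨c, hc0, hc⟩ := hA.exists_energy_le_of_two
  have h1 := one_le_blockCount (m := m) (P := P) (q := q)
  set M := blockCount m P q with hM
  have hal : ∀ {k s u u' t t'}, IsAligned A P 3 s u u' → t ∈ Set.Icc (0 : ℝ) 1 →
      t' ∈ Set.Icc (0 : ℝ) 1 → energy P q s k t t' u u' ≤
        ENNReal.ofReal (2 * M + M * c * k) := fun {k s u u' t t'} h ht ht' => by
    refine h.energy_le_of_next (D := fun k : ℕ => 2 * M + M * c * k)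
      hA (B := fun k => c) (fun k => hc0) (by simp [hM]) (fun k => le_of_eq ?_) ht ht' hc
    push_cast
    ring
  refine ⟨M * (2 * M + M * c + c), by positivity, fun {k s u u' t t'} h ht ht' => ?_⟩
  cases k with
  | zero =>
    refine (energy_zero_le hA h ht ht').trans (ENNReal.ofReal_le_ofReal ?_)
    have : 0 ≤ M * c + c := by positivity
    rw [← hM]
    simp only [Nat.cast_zero, zero_add, mul_one]
    nlinarith
  | succ k =>
    refine (h.energy_le_of_next (k := k) hA (B := fun k => 2 * M + M * c * k + c) ht ht'
      (fun h h1 h2 => (hal h h1 h2).trans (ENNReal.ofReal_le_ofReal (by linarith)))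
      (fun h h1 h2 => (hc h h1 h2).trans (ENNReal.ofReal_le_ofReal ?_))).trans
        (ENNReal.ofReal_le_ofReal ?_)
    · have : 0 ≤ 2 * M + M * c * k := by positivity
      linarith
    · have h2 : (0 : ℝ) ≤ k := Nat.cast_nonneg k
      have h3 : 0 ≤ M * k := by positivity
      have h4 : 0 ≤ c * k := by positivity
      have h5 : 0 ≤ M * c := by positivity
      have key : 2 * M + M * c * k + c ≤ (2 * M + M * c + c) * ((k + 1 : ℕ) + 1) := by
        push_cast
        nlinarith
      calc _ ≤ M * ((2 * M + M * c + c) * ((k + 1 : ℕ) + 1)) :=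
            mul_le_mul_of_nonneg_left key (by linarith)
        _ = _ := by ring

end TreeAut

/-! ### Almost invariant functions from harmonic averages of levels. -/

namespace TreeAut

open Ray Filter Topology

variable {m : ℕ}

/-- The energy `‖g f - f‖²` of a function on the rays. -/
noncomputable def rayEnergy (g : TreeAut m) (f : Ray m → ℝ) : ℝ≥0∞ :=
  ∑' x, ENNReal.ofReal ((f (g.1 x) - f x) ^ 2)

/-- The potential with a transition at block `n`, as a function on the rays. -/
noncomputable def levelFun (P q n : ℕ) (x : Ray m) : ℝ :=
  potential P q n 0 (x.take P) (x.drop P)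

/-- The nonzero terms lie in a window of length `d`, where Cauchy–Schwarz applies. -/
theorem sq_sum_le_of_lacunary {a : ℕ → ℝ} {d : ℕ} (h : ∀ n k, a n ≠ 0 → n + d ≤ k → a k = 0)
    (N : ℕ) : (∑ n ∈ Finset.range N, a n) ^ 2 ≤ d * ∑ n ∈ Finset.range N, a n ^ 2 := by
  set S := (Finset.range N).filter fun n => a n ≠ 0 with hS
  have h1 : ∑ n ∈ Finset.range N, a n = ∑ n ∈ S, a n := (Finset.sum_filter_ne_zero _).symm
  have h2 : ∑ n ∈ Finset.range N, a n ^ 2 = ∑ n ∈ S, a n ^ 2 := by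
    rw [hS, Finset.sum_filter]
    exact Finset.sum_congr rfl fun n _ => by split_ifs with hn <;> simp_all
  have hcard : S.card ≤ d := by
    obtain hS0 | hS0 := S.eq_empty_or_nonempty
    · simp [hS0]
    · have hmin := S.min'_mem hS0
      have : S ⊆ Finset.Ico (S.min' hS0) (S.min' hS0 + d) := fun n hn => by
        refine Finset.mem_Ico.2 ⟨S.min'_le n hn, ?_⟩
        by_contra hlt
        exact (Finset.mem_filter.1 hn).2 (h _ n (Finset.mem_filter.1 hmin).2 (by omega))
      simpa using Finset.card_le_card this
  rw [h1, h2]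
  refine sq_sum_le_card_mul_sum_sq.trans (mul_le_mul_of_nonneg_right (by exact_mod_cast hcard) ?_)
  exact Finset.sum_nonneg fun n _ => sq_nonneg _

variable {A : Set (TreeAut m)} {P q e : ℕ} {s b : TreeAut m} {u u' : List (Fin m)}

theorem levelFun_append (hu : u.length = P) (n : ℕ) (y : Ray m) :
    levelFun P q n (u ++ₛ y) = potential P q n 0 u y := by
  rw [levelFun, take_append hu, drop_append hu]

theorem finite_support_levelFun (hA : IsBlocked A P q) (n : ℕ) :
    (Function.support (levelFun P q n : Ray m → ℝ)).Finite := by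
  refine ((List.finite_length_eq (Fin m) P).biUnion fun u hu =>
    (finite_periodicAfter hA.period_pos hA.le_block hu (n + 1)).image (u ++ₛ ·)).subset ?_
  intro x hx
  simp only [Set.mem_iUnion]
  refine ⟨x.take P, by simp, x.drop P, ?_, Stream'.append_take_drop _ x⟩
  by_contra h
  exact hx (potential_eq_zero hA.block_pos hA.le_block (by simp) h)

theorem levelFun_zeroRay [NeZero m] (hA : IsBlocked A P q) (n : ℕ) :
    levelFun P q n (zeroRay m) = 1 := by
  refine potential_eq_one (PeriodicAfter.mono hA.block_pos hA.le_block (by simp) n.zero_le ?_)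
  rw [PeriodicAfter, Stream'.append_take_drop]
  rfl

variable [NeZero m]

/-- After a bounded delay, input and output become periodic simultaneously. -/
theorem IsConfig.exists_periodicAfter_iff (hA : IsBlocked A P q) (h : IsConfig A P e s u u')
    (y : Ray m) : ∃ j ≤ e + 1, PeriodicAfter P q j u y ↔ PeriodicAfter P q j u' (s.1 y) := by
  induction e generalizing s u u' y with
  | zero =>
    refine ⟨1, le_rfl, ?_⟩
    rw [← Stream'.append_take_drop (q * P) y, TreeAut.apply_append,
      periodicAfter_append (by simp), periodicAfter_append (by simp)]
    exact ((h.next_zero hA (by simp)).periodic_iff _).symm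
  | succ e ih =>
    rw [← Stream'.append_take_drop (q * P) y, TreeAut.apply_append]
    obtain h' | h' := h.next_succ hA (c := y.take (q * P)) (by simp)
    · refine ⟨1, by omega, ?_⟩
      rw [periodicAfter_append (by simp), periodicAfter_append (by simp)]
      exact (h'.periodic_iff _).symm
    · obtain ⟨j, hj, hiff⟩ := ih h' (y.drop (q * P))
      refine ⟨j + 1, by omega, ?_⟩
      rwa [periodicAfter_append (by simp), periodicAfter_append (by simp)]

theorem IsConfig.exists_periodicAfter_add_iff (hA : IsBlocked A P q) (h : IsConfig A P e s u u')
    (n : ℕ) (y : Ray m) : ∃ j ≤ e + 1,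
      PeriodicAfter P q (n + j) u y ↔ PeriodicAfter P q (n + j) u' (s.1 y) := by
  induction n generalizing s u u' y with
  | zero => simpa using h.exists_periodicAfter_iff hA y
  | succ n ih =>
    obtain ⟨j, hj, hiff⟩ := ih (h.next hA (c := y.take (q * P)) (by simp)) (y.drop (q * P))
    refine ⟨j, hj, ?_⟩
    rw [← Stream'.append_take_drop (q * P) y, TreeAut.apply_append, add_right_comm,
      periodicAfter_append (by simp), periodicAfter_append (by simp)]
    exact hiff

/-- If the values at level `n` differ, one end is periodic after `n + 1` blocks; at most `e + 1`
blocks later both are, and from then on both values are 1. -/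
theorem IsConfig.potential_eq (hA : IsBlocked A P q) (h : IsConfig A P e s u u') {t t' : ℝ}
    {n k : ℕ} {y : Ray m}
    (hne : potential P q n t' u' (s.1 y) - potential P q n t u y ≠ 0) (hk : n + (e + 2) ≤ k) :
    potential P q k t' u' (s.1 y) - potential P q k t u y = 0 := by
  obtain ⟨j, hj, hiff⟩ := h.exists_periodicAfter_add_iff hA (n + 1) y
  have hq := hA.block_pos
  have hP := hA.le_block
  have key : PeriodicAfter P q (n + 1 + j) u y := by
    by_contra hcon
    have h1 : ¬ PeriodicAfter P q (n + 1) u y := fun h' =>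
      hcon (h'.mono hq hP h.length_in (by omega))
    have h2 : ¬ PeriodicAfter P q (n + 1) u' (s.1 y) := fun h' =>
      hcon (hiff.2 (h'.mono hq hP h.length_out (by omega)))
    rw [potential_eq_zero hq hP h.length_in h1, potential_eq_zero hq hP h.length_out h2] at hne
    simp at hne
  rw [potential_eq_one (key.mono hq hP h.length_in (by omega)),
    potential_eq_one ((hiff.1 key).mono hq hP h.length_out (by omega)), sub_self]

theorem isConfig_take (hA : IsBlocked A P q) (hb : b ∈ A) (hg : CoreGrowth e b)
    (hu : u.length = P) : IsConfig A P e (sectionAt b u) u (onWord b u) :=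
  ⟨hA.section_mem b hb u, hg.sectionAt u, hu, by simp [hu]⟩

theorem IsBlocked.exists_rayEnergy_le (hA : IsBlocked A P q) : ∃ C : ℝ, 0 ≤ C ∧
    ∀ b ∈ A, CoreGrowth 3 b → ∀ n : ℕ,
      rayEnergy b (levelFun P q n) ≤ ENNReal.ofReal (C * (n + 1)) := by
  obtain ⟨C, hC, h⟩ := hA.exists_energy_le_of_three
  refine ⟨(m : ℝ) ^ P * C, by positivity, fun b hb hg n => ?_⟩
  rw [rayEnergy, tsum_split _ P]
  refine (Finset.sum_le_card_nsmul _ _ (ENNReal.ofReal (C * (n + 1))) fun c _ => ?_).trans_eq ?_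
  · refine le_trans (le_of_eq ?_) (h (k := n)
      (t := 0) (t' := 0) (isConfig_take hA hb hg c.toList_length) (by simp) (by simp))
    refine tsum_congr fun y => ?_
    rw [apply_append, levelFun_append c.toList_length, levelFun_append (by simp)]
  · rw [Finset.card_univ, card_vector, Fintype.card_fin, nsmul_eq_mul, mul_assoc,
      ENNReal.ofReal_mul (p := (m : ℝ) ^ P) (by positivity), ← Nat.cast_pow,
      ENNReal.ofReal_natCast]

theorem levelFun_lacunary (hA : IsBlocked A P q) (hb : b ∈ A) (hg : CoreGrowth 3 b) (x : Ray m)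
    (n k : ℕ) (hne : levelFun P q n (b.1 x) - levelFun P q n x ≠ 0) (hk : n + 5 ≤ k) :
    levelFun P q k (b.1 x) - levelFun P q k x = 0 := by
  rw [← Stream'.append_take_drop P x, apply_append, levelFun_append (by simp),
    levelFun_append (by simp)] at hne ⊢
  exact (isConfig_take hA hb hg (by simp)).potential_eq hA hne hk

/-- A finite set of automorphisms of quadratic activity that is closed under sections almost
fixes a finitely supported function that is not small at the zero ray. -/
theorem exists_almost_invariant (hfin : A.Finite)
    (hsec : ∀ s ∈ A, ∀ v : List (Fin m), sectionAt s v ∈ A) (hg : ∀ b ∈ A, CoreGrowth 3 b) :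
    ∃ f : ℕ → Ray m → ℝ, (∀ N, (Function.support (f N)).Finite) ∧ (∀ N, f N (zeroRay m) = 1) ∧
      ∀ b ∈ A, Tendsto (fun N => rayEnergy b (f N)) atTop (𝓝 0) := by
  obtain ⟨P, q, hA⟩ := exists_isBlocked hfin hsec
  obtain ⟨C, hC, hE⟩ := hA.exists_rayEnergy_le
  set H : ℕ → ℝ := fun N => ∑ n ∈ Finset.range (N + 1), 1 / ((n : ℝ) + 1) with hH
  have hHpos : ∀ N, 0 < H N := fun N => Finset.sum_pos (fun n _ => by positivity) (by simp)
  have hHtop : Tendsto H atTop atTop :=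
    Real.tendsto_sum_range_one_div_nat_succ_atTop.comp (tendsto_add_atTop_nat 1)
  -- Weights inversely proportional to the energy bound `C * (n + 1)`: the weighted energies then
  -- sum to `C / H N`, up to the overlap factor 5.
  set w : ℕ → ℕ → ℝ := fun N n => (H N)⁻¹ * (1 / ((n : ℝ) + 1)) with hw
  set f : ℕ → Ray m → ℝ := fun N x =>
    ∑ n ∈ Finset.range (N + 1), w N n * levelFun P q n x with hf
  refine ⟨f, fun N => ?_, fun N => ?_, fun b hb => ?_⟩
  · refine ((Finset.range (N + 1)).finite_toSet.biUnion fun n _ =>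
      finite_support_levelFun hA n).subset fun x hx => ?_
    obtain ⟨n, hn, hne⟩ := Finset.exists_ne_zero_of_sum_ne_zero hx
    exact Set.mem_biUnion hn (right_ne_zero_of_mul hne)
  · simp only [hf, hw, levelFun_zeroRay hA, mul_one, ← Finset.mul_sum]
    exact inv_mul_cancel₀ (hHpos N).ne'
  · have key : ∀ N, rayEnergy b (f N) ≤ ENNReal.ofReal (5 * C * (H N)⁻¹) := fun N => by
      calc rayEnergy b (f N) ≤ ∑' x, ∑ n ∈ Finset.range (N + 1), ENNReal.ofReal (5 * w N n ^ 2) *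
            ENNReal.ofReal ((levelFun P q n (b.1 x) - levelFun P q n x) ^ 2) :=
            ENNReal.tsum_le_tsum fun x => ?_
        _ = ∑ n ∈ Finset.range (N + 1), ENNReal.ofReal (5 * w N n ^ 2) *
            rayEnergy b (levelFun P q n) := by
            rw [Summable.tsum_finsetSum fun _ _ => ENNReal.summable]
            exact Finset.sum_congr rfl fun n _ => ENNReal.tsum_mul_left
        _ ≤ ∑ n ∈ Finset.range (N + 1), ENNReal.ofReal (5 * w N n ^ 2) *
            ENNReal.ofReal (C * (n + 1)) :=
            Finset.sum_le_sum fun n _ => mul_le_mul_right (hE b hb (hg b hb) n) _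
        _ = ENNReal.ofReal (∑ n ∈ Finset.range (N + 1), 5 * w N n ^ 2 * (C * (n + 1))) := by
            rw [ENNReal.ofReal_sum_of_nonneg fun n _ => by positivity]
            exact Finset.sum_congr rfl fun n _ => (ENNReal.ofReal_mul (by positivity)).symm
        _ = ENNReal.ofReal (5 * C * (H N)⁻¹) := by
            congr 1
            have h1 : ∀ n : ℕ, 5 * w N n ^ 2 * (C * (n + 1)) =
                5 * C * (H N)⁻¹ ^ 2 * (1 / ((n : ℝ) + 1)) := fun n => by
              simp only [hw]; field_simp
            simp only [h1, ← Finset.mul_sum]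
            change 5 * C * (H N)⁻¹ ^ 2 * H N = _
            have := (hHpos N).ne'
            field_simp
      have hlac := sq_sum_le_of_lacunary (d := 5) (a := fun n =>
        w N n * (levelFun P q n (b.1 x) - levelFun P q n x)) (fun n k hn hk => by
          rw [levelFun_lacunary hA hb (hg b hb) x n k (right_ne_zero_of_mul hn) hk, mul_zero])
          (N + 1)
      have h2 : f N (b.1 x) - f N x = ∑ n ∈ Finset.range (N + 1),
          w N n * (levelFun P q n (b.1 x) - levelFun P q n x) := by
        simp only [hf, mul_sub, Finset.sum_sub_distrib]
      rw [h2]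
      refine (ENNReal.ofReal_le_ofReal hlac).trans_eq ?_
      rw [Finset.mul_sum, ENNReal.ofReal_sum_of_nonneg fun n _ => by positivity]
      refine Finset.sum_congr rfl fun n _ => ?_
      rw [← ENNReal.ofReal_mul (by positivity)]
      congr 1
      push_cast
      ring
    refine tendsto_of_tendsto_of_tendsto_of_le_of_le tendsto_const_nhds ?_ (fun _ => zero_le) key
    rw [← ENNReal.ofReal_zero]
    refine ENNReal.tendsto_ofReal ?_
    simpa using (tendsto_inv_atTop_zero.comp hHtop).const_mul (5 * C)

end TreeAut

/-! ### From generators to the whole group. -/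

namespace TreeAut

open Filter Topology

variable {m : ℕ}

theorem rayEnergy_one (f : Ray m → ℝ) : rayEnergy 1 f = 0 := by
  rw [rayEnergy, ENNReal.tsum_eq_zero]
  intro x
  change ENNReal.ofReal ((f x - f x) ^ 2) = 0
  simp

theorem rayEnergy_inv (g : TreeAut m) (f : Ray m → ℝ) : rayEnergy g⁻¹ f = rayEnergy g f := by
  rw [rayEnergy, ← g.1.tsum_eq]
  refine tsum_congr fun x => ?_
  have : (g⁻¹).1 (g.1 x) = x := g.1.symm_apply_apply x
  rw [this, ← neg_sub, neg_sq]

theorem rayEnergy_mul_le (g h : TreeAut m) (f : Ray m → ℝ) :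
    rayEnergy (g * h) f ≤ 2 * rayEnergy g f + 2 * rayEnergy h f := by
  have hg : rayEnergy g f = ∑' x, ENNReal.ofReal ((f (g.1 (h.1 x)) - f (h.1 x)) ^ 2) :=
    (h.1.tsum_eq _).symm
  rw [hg, rayEnergy, rayEnergy, ← ENNReal.tsum_mul_left, ← ENNReal.tsum_mul_left,
    ← ENNReal.tsum_add]
  refine ENNReal.tsum_le_tsum fun x => ?_
  have h2 : (2 : ℝ≥0∞) = ENNReal.ofReal 2 := by simp
  rw [h2, ← ENNReal.ofReal_mul (by norm_num), ← ENNReal.ofReal_mul (by norm_num),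
    ← ENNReal.ofReal_add (by positivity) (by positivity)]
  apply ENNReal.ofReal_le_ofReal
  change (f (g.1 (h.1 x)) - f x) ^ 2 ≤ _
  nlinarith [sq_nonneg (f (g.1 (h.1 x)) - f (h.1 x) - (f (h.1 x) - f x))]

theorem tendsto_rayEnergy_of_closure {A : Set (TreeAut m)} {f : ℕ → Ray m → ℝ}
    (hA : ∀ b ∈ A, Tendsto (fun N => rayEnergy b (f N)) atTop (𝓝 0)) {g : TreeAut m}
    (hg : g ∈ Subgroup.closure A) : Tendsto (fun N => rayEnergy g (f N)) atTop (𝓝 0) := by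
  induction hg using Subgroup.closure_induction with
  | mem g hg => exact hA g hg
  | one => simp only [rayEnergy_one, tendsto_const_nhds]
  | mul g h _ _ ihg ihh =>
    refine tendsto_of_tendsto_of_tendsto_of_le_of_le tendsto_const_nhds ?_ (fun _ => zero_le)
      fun N => rayEnergy_mul_le g h (f N)
    simpa using (ENNReal.Tendsto.const_mul ihg (Or.inr ENNReal.ofNat_ne_top)).add
      (ENNReal.Tendsto.const_mul ihh (Or.inr (ENNReal.ofNat_ne_top (n := 2))))
  | inv g _ ih => simpa only [rayEnergy_inv] using ih

end TreeAut

/-! ### Escape probability bounded by energy. -/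

namespace SchreierWalk

open Filter Topology

/-- The difference of the two sides is a square over `w * z`. This is the edgewise inequality behind
testing a superharmonic `w` against `f ^ 2 / w`. -/
theorem sub_mul_sub_le {a b w z : ℝ} (hw : 0 < w) (hz : 0 < z) :
    (a ^ 2 / w - b ^ 2 / z) * (w - z) ≤ (b - a) ^ 2 := by
  have h : (b - a) ^ 2 - (a ^ 2 / w - b ^ 2 / z) * (w - z) = (a * z - b * w) ^ 2 / (w * z) := by
    field_simp
    ring
  have : 0 ≤ (a * z - b * w) ^ 2 / (w * z) := by positivity
  linarith

section Criterion

variable {V S : Type*} [Fintype S] [Nonempty S] {σ : S → Equiv.Perm V} {o : V}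

open Classical in
/-- The function `p` with its value at `o` replaced by `0`. -/
noncomputable def kill (o : V) (p : V → ℝ) (x : V) : ℝ := if x = o then 0 else p x

/-- The averaging operator of the walk along the permutations `σ s` and their inverses. -/
noncomputable def average (σ : S → Equiv.Perm V) (p : V → ℝ) (x : V) : ℝ :=
  (2 * Fintype.card S : ℝ)⁻¹ * ∑ s, (p (σ s x) + p ((σ s).symm x))

theorem average_mono {p p' : V → ℝ} (h : ∀ x, p x ≤ p' x) (x : V) :
    average σ p x ≤ average σ p' x :=
  mul_le_mul_of_nonneg_left (Finset.sum_le_sum fun _ _ => add_le_add (h _) (h _)) (by positivity)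

theorem average_const (c : ℝ) (x : V) : average σ (fun _ => c) x = c := by
  have : (Fintype.card S : ℝ) ≠ 0 := by exact_mod_cast Fintype.card_ne_zero
  simp only [average, Finset.sum_const, Finset.card_univ, nsmul_eq_mul]
  field_simp
  ring

theorem kill_mono {p p' : V → ℝ} (h : ∀ x, p x ≤ p' x) (x : V) : kill o p x ≤ kill o p' x := by
  unfold kill
  split_ifs
  exacts [le_rfl, h x]

theorem kill_mem {p : V → ℝ} (h : ∀ x, p x ∈ Set.Icc (0 : ℝ) 1) (x : V) :
    kill o p x ∈ Set.Icc (0 : ℝ) 1 := by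
  unfold kill
  split_ifs
  exacts [by simp, h x]

/-- The escape probability at `o` is bounded by the energy of any finitely supported function
with value `1` at `o`. -/
theorem exists_tendsto_le_energy {p : ℕ → V → ℝ} (h0 : ∀ x, p 0 x = 1)
    (hp : ∀ n x, p (n + 1) x = average σ (kill o (p n)) x) : ∃ a, 0 ≤ a ∧
    Tendsto (fun n => p n o) atTop (𝓝 a) ∧ ∀ f : V → ℝ, f.support.Finite →
      Fintype.card S * a * f o ^ 2 ≤ ∑ s, ∑' x, (f (σ s x) - f x) ^ 2 := by
  have hmem : ∀ n x, p n x ∈ Set.Icc (0 : ℝ) 1 := fun n => by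
    induction n with
    | zero => intro x; simp [h0]
    | succ n ih =>
      intro x
      rw [hp]
      refine ⟨?_, ?_⟩
      · exact (average_const (σ := σ) 0 x).symm.trans_le (average_mono (fun y => (kill_mem ih y).1) x)
      · exact (average_mono (fun y => (kill_mem ih y).2) x).trans_eq (average_const (σ := σ) 1 x)
  have hanti : ∀ n x, p (n + 1) x ≤ p n x := fun n => by
    induction n with
    | zero => intro x; rw [h0]; exact (hmem 1 x).2
    | succ n ih => intro x; rw [hp, hp n]; exact average_mono (kill_mono ih) x
  have hlim : ∀ x, ∃ a, Tendsto (fun n => p n x) atTop (𝓝 a) := fun x =>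
    ⟨_, tendsto_atTop_ciInf (antitone_nat_of_succ_le fun n => hanti n x)
      ⟨0, by rintro _ ⟨n, rfl⟩; exact (hmem n x).1⟩⟩
  choose l hl using hlim
  have hlmem : ∀ x, l x ∈ Set.Icc (0 : ℝ) 1 := fun x =>
    isClosed_Icc.mem_of_tendsto (hl x) (Eventually.of_forall fun n => hmem n x)
  have hkill : ∀ x, Tendsto (fun n => kill o (p n) x) atTop (𝓝 (kill o l x)) := fun x => by
    unfold kill
    split_ifs
    exacts [tendsto_const_nhds, hl x]
  have hfix : ∀ x, l x = average σ (kill o l) x := fun x => by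
    refine tendsto_nhds_unique ((tendsto_add_atTop_iff_nat 1).2 (hl x)) ?_
    simp only [hp]
    exact (tendsto_finsetSum _ fun s _ => (hkill _).add (hkill _)).const_mul _
  refine ⟨l o, (hlmem o).1, hl o, fun f hf => ?_⟩
  -- The limit `l` is the escape probability. This `w` is harmonic off `o`, its Laplacian at `o` is
  -- a multiple of `l o`, and the constant 2 keeps it positive.
  set w : V → ℝ := fun x => 2 - kill o l x with hw
  have hw1 : ∀ x, 0 < w x := fun x => by
    have := (kill_mem (o := o) hlmem x).2
    simp only [hw]; linarith
  have hwo : w o = 2 := by simp [hw, kill]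
  have hS : (Fintype.card S : ℝ) ≠ 0 := by exact_mod_cast Fintype.card_ne_zero
  have hlap : ∀ x, ∑ s, ((w x - w (σ s x)) + (w x - w ((σ s).symm x))) =
      2 * Fintype.card S * (l x - kill o l x) := fun x => by
    have h1 := hfix x
    rw [average, eq_inv_mul_iff_mul_eq₀ (by positivity)] at h1
    rw [mul_sub, h1]
    simp only [hw, Finset.sum_add_distrib, Finset.sum_sub_distrib, Finset.sum_const,
      Finset.card_univ, nsmul_eq_mul]
    ring
  -- Summing the Laplacian of `w` against `φ` leaves only the term at `o`; summation by parts makes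
  -- it a sum over edges, bounded termwise by the energy of `f`.
  set φ : V → ℝ := fun x => f x ^ 2 / w x with hφ
  have hφf : φ.support.Finite := hf.subset fun x hx hx' => hx (by simp [hφ, hx'])
  have hφσ : ∀ s, (fun x => φ (σ s x)).support.Finite := fun s =>
    (hφf.image (σ s).symm).subset fun x hx => ⟨σ s x, hx, by simp⟩
  have hs1 : ∀ τ : V → V, Summable fun x => φ x * (w x - w (τ x)) := fun _ =>
    summable_of_hasFiniteSupport (hφf.subset fun x hx => left_ne_zero_of_mul hx)
  have hs2 : ∀ s, Summable fun x => φ (σ s x) * (w (σ s x) - w x) := fun s =>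
    summable_of_hasFiniteSupport ((hφσ s).subset fun x hx => left_ne_zero_of_mul hx)
  have hs3 : ∀ s, Summable fun x => (f (σ s x) - f x) ^ 2 := fun s => by
    refine summable_of_hasFiniteSupport ((hf.union (hf.image (σ s).symm)).subset fun x hx => ?_)
    by_contra hcon
    simp only [Set.mem_union, Function.mem_support, not_or, not_not] at hcon
    refine hx ?_
    have : f (σ s x) = 0 := by
      by_contra h
      exact hcon.2 ⟨σ s x, h, by simp⟩
    simp [this, hcon.1]
  calc (Fintype.card S : ℝ) * l o * f o ^ 2
      = φ o * (2 * Fintype.card S * (l o - kill o l o)) := by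
        simp only [hφ, hwo, kill, if_true]; ring
    _ = ∑' x, φ x * (2 * Fintype.card S * (l x - kill o l x)) :=
        (tsum_eq_single (f := fun x => φ x * (2 * Fintype.card S * (l x - kill o l x))) o
          fun x hx => by simp [kill, hx]).symm
    _ = ∑' x, ∑ s, (φ x * (w x - w (σ s x)) + φ x * (w x - w ((σ s).symm x))) := by
        simp only [← hlap, Finset.mul_sum, mul_add]
    _ = ∑ s, ∑' x, (φ x * (w x - w (σ s x)) + φ x * (w x - w ((σ s).symm x))) :=
        Summable.tsum_finsetSum fun s _ => (hs1 _).add (hs1 _)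
    _ = ∑ s, ∑' x, (φ x * (w x - w (σ s x)) + φ (σ s x) * (w (σ s x) - w x)) := by
        refine Finset.sum_congr rfl fun s _ => ?_
        rw [(hs1 _).tsum_add (hs1 _), (hs1 _).tsum_add (hs2 s), ← (σ s).tsum_eq
          (fun x => φ x * (w x - w ((σ s).symm x)))]
        simp only [Equiv.symm_apply_apply]
    _ ≤ _ := by
        refine Finset.sum_le_sum fun s _ =>
          ((hs1 _).add (hs2 s)).tsum_le_tsum (fun x => ?_) (hs3 s)
        have := sub_mul_sub_le (a := f x) (b := f (σ s x)) (hw1 x) (hw1 (σ s x))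
        simp only [hφ]
        linarith

end Criterion

end SchreierWalk

/-! ### The walk on the Schreier quiver as an averaging operator. -/

namespace SchreierWalk

open Filter Topology

section Star

variable {V M S : Type*} [Group M] [MulAction M V] (ι : S → M)

/-- The arrows out of a vertex of the symmetrified Schreier graph. -/
def starEquiv (x : Quiver.SchreierGraph V ι) :
    S ⊕ S ≃ Quiver.Star (U := Quiver.Symmetrify (Quiver.SchreierGraph V ι)) x where
  toFun i := i.elim
    (fun s => ⟨(ι s • x : Quiver.SchreierGraph V ι), Sum.inl ⟨s, rfl⟩⟩)
    (fun s => ⟨((ι s)⁻¹ • x : Quiver.SchreierGraph V ι), Sum.inr ⟨s, smul_inv_smul _ _⟩⟩)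
  invFun e := e.2.elim (fun a => Sum.inl a.1) (fun a => Sum.inr a.1)
  left_inv i := by rcases i with s | s <;> rfl
  right_inv := by
    rintro ⟨y, ⟨s, h⟩ | ⟨s, h⟩⟩
    · subst h; rfl
    · obtain rfl := eq_inv_smul_iff.2 h
      rfl

open Classical in
theorem avoidProb_succ [Fintype S] (o x : Quiver.SchreierGraph V ι) (n : ℕ) :
    avoidProb (V := Quiver.Symmetrify (Quiver.SchreierGraph V ι)) o (n + 1) x =
      ∑ i : S ⊕ S, if (starEquiv ι x i).1 = o then 0 else
        (2 * Fintype.card S : ℝ≥0∞)⁻¹ *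
          avoidProb (V := Quiver.Symmetrify (Quiver.SchreierGraph V ι)) o n (starEquiv ι x i).1 := by
  have hcard : ((ENat.card (Quiver.Star (U := Quiver.Symmetrify (Quiver.SchreierGraph V ι)) x) :
      ℕ∞) : ℝ≥0∞) = 2 * Fintype.card S := by
    rw [← ENat.card_congr (starEquiv ι x), ENat.card_eq_coe_fintype_card, Fintype.card_sum]
    push_cast
    ring
  refine (avoidProb.eq_2 (V := Quiver.Symmetrify (Quiver.SchreierGraph V ι)) o x n).trans ?_
  rw [← (starEquiv ι x).tsum_eq, tsum_fintype]
  simp only [hcard]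

/-- The permutation of the vertices of the Schreier graph given by the generator `s`. -/
def genPerm (s : S) : Equiv.Perm (Quiver.SchreierGraph V ι) where
  toFun x := ι s • x
  invFun x := (ι s)⁻¹ • x
  left_inv x := inv_smul_smul _ x
  right_inv x := smul_inv_smul _ x

theorem avoidProb_ne_top [Fintype S] (o x : Quiver.SchreierGraph V ι) (n : ℕ) :
    avoidProb (V := Quiver.Symmetrify (Quiver.SchreierGraph V ι)) o n x ≠ ⊤ := by
  induction n generalizing x with
  | zero => simp [avoidProb]
  | succ n ih =>
    rw [avoidProb_succ, ENNReal.sum_ne_top]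
    intro i _
    split_ifs
    · simp
    · refine ENNReal.mul_ne_top (ENNReal.inv_ne_top.2 ?_) (ih _)
      have : Nonempty S := i.elim (fun s => ⟨s⟩) fun s => ⟨s⟩
      simp

theorem toReal_avoidProb_succ [Fintype S] (o x : Quiver.SchreierGraph V ι) (n : ℕ) :
    (avoidProb (V := Quiver.Symmetrify (Quiver.SchreierGraph V ι)) o (n + 1) x).toReal =
      average (genPerm ι) (kill o fun y =>
        (avoidProb (V := Quiver.Symmetrify (Quiver.SchreierGraph V ι)) o n y).toReal) x := by
  classical
  rw [avoidProb_succ, ENNReal.toReal_sum, average, Fintype.sum_sum_type, Finset.sum_add_distrib,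
    mul_add, Finset.mul_sum, Finset.mul_sum]
  · congr 1 <;>
    · refine Finset.sum_congr rfl fun s _ => ?_
      rw [kill, apply_ite ENNReal.toReal, mul_ite, ENNReal.toReal_mul, ENNReal.toReal_inv]
      simp
      rfl
  · intro i _
    split_ifs
    · simp
    · refine ENNReal.mul_ne_top (ENNReal.inv_ne_top.2 ?_) (avoidProb_ne_top ι o _ n)
      have : Nonempty S := i.elim (fun s => ⟨s⟩) fun s => ⟨s⟩
      simp

/-- A Schreier graph with almost invariant finitely supported functions is recurrent. -/
theorem isRecurrent_of_energy [Finite S] (H : ∀ o : Quiver.SchreierGraph V ι,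
    ∃ f : ℕ → Quiver.SchreierGraph V ι → ℝ, (∀ N, (Function.support (f N)).Finite) ∧
      Tendsto (fun N => f N o) atTop (𝓝 1) ∧
      ∀ s, Tendsto (fun N => ∑' x, (f N (ι s • x) - f N x) ^ 2) atTop (𝓝 0)) :
    IsRecurrent (Quiver.Symmetrify (Quiver.SchreierGraph V ι)) := by
  classical
  have := Fintype.ofFinite S
  refine ⟨fun x => Finite.of_equiv _ (starEquiv ι x), fun o => ?_⟩
  obtain hS | hS := isEmpty_or_nonempty S
  -- Without generators there are no arrows, and `avoidProb` is an empty sum from time 1 on.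
  · refine (tendsto_add_atTop_iff_nat 1).1 ?_
    refine (tendsto_congr fun n => ?_).2 tendsto_const_nhds
    exact (avoidProb_succ ι o o n).trans (by simp)
  · obtain ⟨f, hfin, hone, hE⟩ := H o
    obtain ⟨a, ha0, ha, hle⟩ := exists_tendsto_le_energy (σ := genPerm ι) (o := o)
      (p := fun n x =>
        (avoidProb (V := Quiver.Symmetrify (Quiver.SchreierGraph V ι)) o n x).toReal)
      (fun x => by simp [avoidProb]) (fun n x => toReal_avoidProb_succ ι o x n)
    have h1 : Fintype.card S * a * 1 ^ 2 ≤ ∑ s : S, (0 : ℝ) :=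
      le_of_tendsto_of_tendsto' ((hone.pow 2).const_mul _)
        (tendsto_finsetSum _ fun s _ => hE s) fun N => hle (f N) (hfin N)
    have hc : (0 : ℝ) < Fintype.card S := by exact_mod_cast Fintype.card_pos
    obtain rfl : a = 0 := by
      rw [one_pow, mul_one, Finset.sum_const_zero] at h1
      exact le_antisymm (by by_contra! h; linarith [mul_pos hc h]) ha0
    have := ENNReal.tendsto_ofReal ha
    simpa only [ENNReal.ofReal_toReal (avoidProb_ne_top ι o o _), ENNReal.ofReal_zero] using this

end Star

end SchreierWalk

/-! ### Recurrence of the orbit graph. -/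

open TreeAut Filter Topology in
theorem theorem1p2 (m : ℕ) [NeZero m] (G : Subgroup (TreeAut m))
    (hG : IsAutomatonGroup G) (hdeg : HasDegree G 2)
    (S : Set G) (hfin : S.Finite) (hgen : Subgroup.closure S = ⊤) :
    IsRecurrent (OrbitSchreierGraph G S (zeroRay m)) := by
  obtain ⟨A, hA, hsec, hcl⟩ := hG
  obtain ⟨f, hf, hone, hE⟩ := exists_almost_invariant hA hsec fun b hb =>
    coreGrowth_of_isBigO (hdeg b (hcl ▸ Subgroup.subset_closure hb))
  have hEG : ∀ g : G, Tendsto (fun N => rayEnergy g.1 (f N)) atTop (𝓝 0) := fun g =>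
    tendsto_rayEnergy_of_closure hE (hcl ▸ g.2)
  have := hfin.to_subtype
  refine SchreierWalk.isRecurrent_of_energy _ fun o => ⟨fun N x => f N x.toVertex.1, fun N => ?_,
    ?_, fun s => ?_⟩
  · exact (hf N).preimage (f := fun x : Quiver.SchreierGraph (MulAction.orbit G (zeroRay m))
      (fun s : S => (s : G)) => x.toVertex.1) fun x _ y _ h =>
        Quiver.SchreierGraph.ext (Subtype.ext h)
  · obtain ⟨⟨_, g, rfl⟩⟩ := o
    -- The single pair from the zero ray to its image under `g` is one term of the energy of `g`, so
    -- the value 1 at the zero ray propagates to every point of the orbit in the limit.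
    have h0 : Tendsto (fun N => (f N (g • zeroRay m) - f N (zeroRay m)) ^ 2) atTop (𝓝 0) := by
      have h1 : ∀ N, ENNReal.ofReal ((f N (g • zeroRay m) - f N (zeroRay m)) ^ 2) ≤
          rayEnergy g.1 (f N) := fun N => ENNReal.le_tsum (zeroRay m)
      have h2 := tendsto_of_tendsto_of_tendsto_of_le_of_le tendsto_const_nhds (hEG g)
        (fun _ => zero_le) h1
      have h3 := (ENNReal.tendsto_toReal ENNReal.zero_ne_top).comp h2
      simpa [Function.comp_def, ENNReal.toReal_ofReal (sq_nonneg _)] using h3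
    have h1 : Tendsto (fun N => f N (g • zeroRay m) - f N (zeroRay m)) atTop (𝓝 0) := by
      rw [tendsto_zero_iff_abs_tendsto_zero]
      simpa [Function.comp_def, Real.sqrt_sq_eq_abs] using h0.sqrt
    simpa [hone] using h1.add_const 1
  · set F : ℕ → Quiver.SchreierGraph (MulAction.orbit G (zeroRay m)) (fun s : S => (s : G)) → ℝ :=
      fun N x => (f N ((s : G) • x).toVertex.1 - f N x.toVertex.1) ^ 2
    have hF : ∀ N x, 0 ≤ F N x := fun N x => sq_nonneg _
    -- The orbit injects into the rays, so its energy is a partial sum; in the non-summable case the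
    -- real sum is 0 by convention and the bound is trivial.
    have h1 : ∀ N, ENNReal.ofReal (∑' x, F N x) ≤ rayEnergy (s : G).1 (f N) := fun N => by
      by_cases hs : Summable (F N)
      · rw [ENNReal.ofReal_tsum_of_nonneg (hF N) hs]
        exact ENNReal.tsum_comp_le_tsum_of_injective (f := fun x : Quiver.SchreierGraph
          (MulAction.orbit G (zeroRay m)) (fun s : S => (s : G)) => x.toVertex.1)
          (fun x y h => Quiver.SchreierGraph.ext (Subtype.ext h))
          (fun x => ENNReal.ofReal ((f N ((s : G).1.1 x) - f N x) ^ 2))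
      · simp [tsum_eq_zero_of_not_summable hs]
    have h2 := tendsto_of_tendsto_of_tendsto_of_le_of_le tendsto_const_nhds (hEG s)
      (fun _ => zero_le) h1
    have h3 := (ENNReal.tendsto_toReal ENNReal.zero_ne_top).comp h2
    simpa only [Function.comp_def, ENNReal.toReal_ofReal (tsum_nonneg (hF _)),
      ENNReal.toReal_zero] using h3
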